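/- Let $m\ge 1$, $r,N\ge 0$, and write $z=(z_1,z')$ with $z'=(z_2,\dots,z_m)$. Let $P_1(z),\dots,P_m(z)$ be $r\times r$ matrices of holomorphic functions near $z=0\in\mathbb C^m$ such that the logarithmic Pfaffian system $$\partial_1 I=\frac{P_1(z)}{z_1}\,I,\qquad \partial_i I=P_i(z)\,I\quad(i=2,\dots,m)\qquad(\ast)$$ is integrable: with $A_1=P_1/z_1$ and $A_i=P_i$ for $i\ge2$, one has $\partial_iA_j-\partial_jA_i=A_iA_j-A_jA_i$ for all $i,j$, near $0$ and off $\{z_1=0\}$. Put $P_{1,-1}(z')=P_1(0,z')$ (the residue matrix) and $P_{i,0}(z')=P_i(0,z')$ for $i\ge2$. Suppose that $P_{1,-1}(0)$ is non-resonant, i.e. no two distinct eigenvalues of it differ by an integer, and that no positive integer is an eigenvalue of it. Consider two sets. (a) The solutions of $(\ast)$ of the form $$I(z)=I^{(0)}(z)+I^{(1)}(z)\log z_1+\dots+I^{(N)}(z)\log^N z_1,$$ with every $I^{(n)}$ a $\mathbb C^r$-valued holomorphic function near $z=0$. Here $\log$ is the principal branch, $z$ ranges over a neighbourhood of $0$ slit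 along $z_1\in(-\infty,0]$, and two solutions are identified when they agree on a smaller such slit neighbourhood. (b) The tuples $(J^{(0)},\dots,J^{(N)})$ of germs at $z'=0$ of $\mathbb C^r$-valued holomorphic functions that solve the logarithmic restriction of $(\ast)$ at order $N$: $$\partial_iJ^{(n)}=P_{i,0}(z')\,J^{(n)}\quad(i=2,\dots,m),\qquad P_{1,-1}(z')\,J^{(n)}=(n+1)\,J^{(n+1)},\qquad n=0,\dots,N,$$ where $J^{(N+1)}=0$. Then the germs at $0$ of the coefficients $I^{(0)},\dots,I^{(N)}$ are uniquely determined by $I$, and the boundary value map $$I\longmapsto\bigl(I^{(0)}(0,z'),\dots,I^{(N)}(0,z')\bigr)$$ is a bijection from the set (a) onto the set (b). Moreover $I$ is already determined by $I^{(0)}(0,z')$, i.e. $I\mapsto I^{(0)}(0,z')$ is injective on (a), so it is a bijection from (a) onto the set of zeroth components $J^{(0)}$ of the elements of (b). -/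

import Mathlib

open Filter Topology

/-- The partial derivative `∂f/∂zᵢ` of a function of `n` complex variables. -/
noncomputable def partialDeriv {n : ℕ} {V : Type*} [NormedAddCommGroup V] [NormedSpace ℂ V]
    (i : Fin n) (f : (Fin n → ℂ) → V) (z : Fin n → ℂ) : V :=
  fderiv ℂ f z (Pi.single i 1)

/-- The coefficient matrices of the logarithmic Pfaffian system attached to `P`: they are
`z₁⁻¹ P₁(z), P₂(z), …, P_m(z)`, where `m = d + 1`. The coordinate `z₁` has index `0 : Fin (d + 1)`
and `z' = (z₂, …, z_m)` has the indices `i.succ` with `i : Fin d`. -/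
noncomputable def logPfaffian {d r : ℕ}
    (P : Fin (d + 1) → (Fin (d + 1) → ℂ) → Matrix (Fin r) (Fin r) ℂ) :
    Fin (d + 1) → (Fin (d + 1) → ℂ) → Matrix (Fin r) (Fin r) ℂ :=
  fun i z => if i = 0 then (z 0)⁻¹ • P 0 z else P i z

/-- Integrability `∂ᵢ Aⱼ - ∂ⱼ Aᵢ = [Aᵢ, Aⱼ]` of the Pfaffian system `∂ᵢ I = Aᵢ I`, at all points
near the origin that lie off the hyperplane `z₁ = 0`. Derivatives are taken entrywise. -/
def IsIntegrablePfaffian {d r : ℕ}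
    (A : Fin (d + 1) → (Fin (d + 1) → ℂ) → Matrix (Fin r) (Fin r) ℂ) : Prop :=
  ∀ᶠ z in 𝓝 (0 : Fin (d + 1) → ℂ), z 0 ≠ 0 → ∀ i j : Fin (d + 1), ∀ a b : Fin r,
    partialDeriv i (fun w => A j w a b) z - partialDeriv j (fun w => A i w a b) z
      = (A i z * A j z - A j z * A i z) a b

/-- A matrix is non-resonant when no two distinct eigenvalues have an integral difference. -/
def NonResonant {r : ℕ} (M : Matrix (Fin r) (Fin r) ℂ) : Prop :=
  ∀ a ∈ spectrum ℂ M, ∀ b ∈ spectrum ℂ M, a ≠ b → ∀ k : ℤ, a - b ≠ (k : ℂ)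

/-- Neighbourhoods of the origin, slit along `z₁ ∈ (-∞, 0]`: the domains on which `log z₁` is a
single-valued (principal) branch. -/
noncomputable def slitNhds (d : ℕ) : Filter (Fin (d + 1) → ℂ) :=
  𝓝[{z | z 0 ∈ Complex.slitPlane}] 0

/-- The function `I⁽⁰⁾(z) + I⁽¹⁾(z) log z₁ + … + I⁽ᴺ⁾(z) logᴺ z₁`. -/
noncomputable def logExpansion {d r N : ℕ}
    (I : Fin (N + 1) → (Fin (d + 1) → ℂ) → (Fin r → ℂ)) : (Fin (d + 1) → ℂ) → (Fin r → ℂ) :=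
  fun z => ∑ n : Fin (N + 1), Complex.log (z 0) ^ (n : ℕ) • I n z

/-- The germs, on slit neighbourhoods of the origin, of the solutions of the logarithmic Pfaffian
system `∂₁ F = z₁⁻¹ P₁ F`, `∂ᵢ F = Pᵢ F` (`i ≥ 2`) of the form
`F = I⁽⁰⁾ + I⁽¹⁾ log z₁ + … + I⁽ᴺ⁾ logᴺ z₁` with `I⁽ⁿ⁾` holomorphic at the origin. -/
def logSolutions {d r : ℕ}
    (P : Fin (d + 1) → (Fin (d + 1) → ℂ) → Matrix (Fin r) (Fin r) ℂ) (N : ℕ) :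
    Set (Germ (slitNhds d) (Fin r → ℂ)) :=
  {F | ∃ I : Fin (N + 1) → (Fin (d + 1) → ℂ) → (Fin r → ℂ),
    (∀ n, AnalyticAt ℂ (I n) 0) ∧ F = (logExpansion I : Germ (slitNhds d) (Fin r → ℂ)) ∧
    ∀ᶠ z in slitNhds d, ∀ i : Fin (d + 1),
      partialDeriv i (logExpansion I) z = (logPfaffian P i z).mulVec (logExpansion I z)}

/-- The germs at the origin of `z'`-space of the holomorphic solutions `(J⁽⁰⁾, …, J⁽ᴺ⁾)` of the
logarithmic restriction at order `N`: `∂ᵢ J⁽ⁿ⁾ = Pᵢ(0, z') J⁽ⁿ⁾` for `i ≥ 2` and `0 ≤ n ≤ N`, and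
`P₁(0, z') J⁽ⁿ⁾ = (n + 1) J⁽ⁿ⁺¹⁾` for `0 ≤ n ≤ N`, where `J⁽ᴺ⁺¹⁾ = 0`. Here `P₁(0, z')` is the residue
matrix (the coefficient of `z₁⁻¹` of `z₁⁻¹ P₁`) and `Pᵢ(0, z')` is the coefficient of `z₁⁰` of
`Pᵢ`. -/
def restrictedSolutions {d r : ℕ}
    (P : Fin (d + 1) → (Fin (d + 1) → ℂ) → Matrix (Fin r) (Fin r) ℂ) (N : ℕ) :
    Set (Fin (N + 1) → Germ (𝓝 (0 : Fin d → ℂ)) (Fin r → ℂ)) :=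
  {G | ∃ J : Fin (N + 1) → (Fin d → ℂ) → (Fin r → ℂ),
    (∀ n, AnalyticAt ℂ (J n) 0) ∧
    (∀ n, G n = (J n : Germ (𝓝 (0 : Fin d → ℂ)) (Fin r → ℂ))) ∧
    ∀ᶠ z' in 𝓝 (0 : Fin d → ℂ),
      (∀ (i : Fin d) (n : Fin (N + 1)),
        partialDeriv i (J n) z' = (P i.succ (Fin.cons 0 z')).mulVec (J n z')) ∧
      (∀ n : Fin N, (P 0 (Fin.cons 0 z')).mulVec (J n.castSucc z')
        = (((n : ℕ) : ℂ) + 1) • J n.succ z') ∧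
      (P 0 (Fin.cons 0 z')).mulVec (J (Fin.last N) z') = 0}

/-- The boundary value `z' ↦ I(0, z')` of a function `I(z₁, z')`. -/
def boundaryValue {d r : ℕ} (I : (Fin (d + 1) → ℂ) → (Fin r → ℂ)) : (Fin d → ℂ) → (Fin r → ℂ) :=
  fun z' => I (Fin.cons 0 z')

/-! The logarithms are absorbed into a larger system. Let `Y` be the tuple of coefficients and `D`
the operator acting on tuples as `d/dL` acts on `∑ Lⁿ vₙ`. By the product rule, and because log
coefficients are unique, the expansion solves the Pfaffian system exactly when `z₁∂₁ Y = (P₁ - D) Y`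
and `∂ᵢ Y = Pᵢ Y` for `i ≥ 2`. Since `D` is constant and commutes with the matrices, the larger
system is again integrable; since the residue `P₁ - D` is block triangular in the tuple index, no
positive integer is an eigenvalue of it at the origin.

The core is that such a system has exactly one holomorphic solution for each value at the origin in
the kernel of the residue (`exists_logSystem_solution`, `logSystem_unique`). Contracting with the
Euler field gives the single equation `∑ zᵢ∂ᵢ Y = M Y`, where `M 0` is the residue. Its homogeneous
terms obey `(k - M 0) Y_k = ∑_{j≥1} M_j Y_{k-j}`, which is solvable with geometric bounds because
the inverses are bounded. By flatness, the defects in the separate equations again satisfy Euler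
equations and vanish at the origin, so they are zero.

On `z₁ = 0` the first equation becomes `(P₁ - D) J = 0` and the others form a regular Pfaffian
system in `z'`. So a restricted solution is fixed by its value at the origin, and that value lies in
the required kernel. The kernel relations recover each `J⁽ⁿ⁺¹⁾` from `J⁽ⁿ⁾`. -/

/-! ### Euler-type equations: uniqueness. -/

/-- On a line, a solution of `t r' = A r` that vanishes at `0` vanishes identically, provided no
positive integer is an eigenvalue of `A 0`. -/
theorem eventually_eq_zero_of_euler_one_dim {E : Type*} [NormedAddCommGroup E] [NormedSpace ℂ E]
    [CompleteSpace E] {r : ℂ → E} {A : ℂ → E →L[ℂ] E} (hr : AnalyticAt ℂ r 0)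
    (hA : ContinuousAt A 0) (h : ∀ᶠ t in 𝓝 (0 : ℂ), t • deriv r t = A t (r t)) (h0 : r 0 = 0)
    (hk : ∀ k : ℕ, 1 ≤ k → ∀ v, A 0 v = (k : ℂ) • v → v = 0) : ∀ᶠ t in 𝓝 (0 : ℂ), r t = 0 := by
  by_contra hne
  -- If `r` is not identically zero, write `r = tⁿ g` with `g 0 ≠ 0`. The leading terms then give `A
  -- 0 (g 0) = n • g 0`, and `n ≥ 1` because `r 0 = 0`.
  obtain ⟨n, g, hg, hg0, hrg⟩ := hr.exists_eventuallyEq_pow_smul_nonzero_iff.2 hne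
  simp only [sub_zero] at hrg
  have hn : 1 ≤ n := by
    rcases Nat.eq_zero_or_pos n with rfl | hn
    · have := hrg.self_of_nhds
      simp only [h0, pow_zero, one_smul] at this
      exact absurd this.symm hg0
    · exact hn
  have key : ∀ᶠ t in 𝓝[≠] (0 : ℂ), (n : ℂ) • g t + t • deriv g t = A t (g t) := by
    filter_upwards [h.filter_mono nhdsWithin_le_nhds, hrg.filter_mono nhdsWithin_le_nhds,
      hrg.eventually_nhds.filter_mono nhdsWithin_le_nhds,
      hg.eventually_analyticAt.filter_mono nhdsWithin_le_nhds, self_mem_nhdsWithin]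
      with t h1 h2 h3 h4 ht
    have hd : HasDerivAt r (t ^ n • deriv g t + ((n : ℂ) * t ^ (n - 1)) • g t) t :=
      ((hasDerivAt_pow n t).smul h4.differentiableAt.hasDerivAt).congr_of_eventuallyEq h3
    rw [hd.deriv, h2, map_smul, smul_add, smul_smul, smul_smul] at h1
    have hp : t * (n * t ^ (n - 1)) = t ^ n * n := by
      obtain ⟨m, rfl⟩ := Nat.exists_eq_add_of_le' hn
      simp [pow_succ]; ring
    have ht' : t ^ n ≠ 0 := pow_ne_zero _ ht
    apply smul_right_injective E ht'
    simp only
    rw [← h1, hp, smul_add, smul_smul, smul_smul, mul_comm t (t ^ n), add_comm]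
  have hc1 : Tendsto (fun t : ℂ => (n : ℂ) • g t + t • deriv g t) (𝓝[≠] 0) (𝓝 ((n : ℂ) • g 0)) := by
    have : ContinuousAt (fun t : ℂ => (n : ℂ) • g t + t • deriv g t) 0 :=
      (continuousAt_const.smul hg.continuousAt).add (continuousAt_id.smul hg.deriv.continuousAt)
    have h2 := this.tendsto
    simp only [zero_smul, add_zero] at h2
    exact h2.mono_left nhdsWithin_le_nhds
  have hc2 : Tendsto (fun t : ℂ => A t (g t)) (𝓝[≠] 0) (𝓝 (A 0 (g 0))) :=
    (hA.clm_apply hg.continuousAt).tendsto.mono_left nhdsWithin_le_nhds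
  exact hg0 (hk n hn _ (tendsto_nhds_unique_of_eventuallyEq hc2 hc1 (key.mono fun _ h => h.symm)))

/-- A solution of the Euler-type equation `∑ zᵢ ∂ᵢ R = A R` that vanishes at the origin vanishes
identically, provided no positive integer is an eigenvalue of `A 0`. -/
theorem eventually_eq_zero_of_euler {V E : Type*} [NormedAddCommGroup V] [NormedSpace ℂ V]
    [NormedAddCommGroup E] [NormedSpace ℂ E] [CompleteSpace E]
    {R : V → E} {A : V → E →L[ℂ] E} (hR : AnalyticAt ℂ R 0) (hA : ContinuousAt A 0)
    (h : ∀ᶠ z in 𝓝 (0 : V), fderiv ℂ R z z = A z (R z)) (h0 : R 0 = 0)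
    (hk : ∀ k : ℕ, 1 ≤ k → ∀ v, A 0 v = (k : ℂ) • v → v = 0) : ∀ᶠ z in 𝓝 (0 : V), R z = 0 := by
  obtain ⟨ε, hε, hball⟩ := Metric.eventually_nhds_iff_ball.1 hR.eventually_analyticAt
  filter_upwards [Metric.ball_mem_nhds 0 hε] with z hz
  -- Along the line `t ↦ t • z` the Euler field becomes `t d/dt`.
  let l : ℂ →L[ℂ] V := (ContinuousLinearMap.id ℂ ℂ).smulRight z
  have hl : ∀ t, l t = t • z := fun t => rfl
  have hconv : Convex ℝ (l ⁻¹' Metric.ball 0 ε) :=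
    (convex_ball (0 : V) ε).linear_preimage (l.toLinearMap.restrictScalars ℝ)
  have han : AnalyticOnNhd ℂ (fun t => R (l t)) (l ⁻¹' Metric.ball 0 ε) := fun t ht =>
    (hball _ ht).comp (l.analyticAt t)
  have h0mem : (0 : ℂ) ∈ l ⁻¹' Metric.ball 0 ε := by simp [hε]
  have hl0 : Tendsto l (𝓝 0) (𝓝 0) := by
    simpa using l.continuous.tendsto 0
  have hz0 : ∀ᶠ t in 𝓝 (0 : ℂ), R (l t) = 0 := by
    refine eventually_eq_zero_of_euler_one_dim (A := fun t => A (l t)) (han 0 h0mem) ?_ ?_ ?_ ?_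
    · exact ContinuousAt.comp (by simpa using hA) l.continuous.continuousAt
    · filter_upwards [hl0.eventually h, hl0.eventually hR.eventually_analyticAt] with t ht hta
      have hd : HasDerivAt (fun t => R (l t)) (fderiv ℂ R (l t) z) t := by
        have := hta.differentiableAt.hasFDerivAt.comp_hasDerivAt t l.hasDerivAt
        simpa [hl, Function.comp_def] using this
      rw [hd.deriv, ← ht, hl, map_smul]
    · simpa using h0
    · simpa using hk
  -- The parameters that land in the ball form a convex set containing `0` and `1`, so vanishing
  -- near `t = 0` propagates to `t = 1`, the point `z` itself.
  have := han.eqOn_of_preconnected_of_eventuallyEq (g := fun _ => 0) (fun _ _ => analyticAt_const)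
    hconv.isPreconnected h0mem hz0 (x := 1) (by simpa [hl] using hz)
  simpa [hl] using this

/-! ### Euler-type equations: existence by power series. -/

/-- If no positive integer lies in the spectrum of `T`, the inverses `(k - T)⁻¹` are bounded. -/
theorem exists_bound_resolvent_nat {B : Type*} [NormedRing B] [NormedAlgebra ℂ B]
    [CompleteSpace B] (T : B) : ∃ C : ℝ, 0 < C ∧ ∀ k : ℕ, ‖resolvent T (k : ℂ)‖ ≤ C := by
  have h1 : Tendsto (fun k : ℕ => (k : ℂ)) atTop (Bornology.cobounded ℂ) :=
    tendsto_natCast_atTop_cobounded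
  -- The resolvent tends to `0` at infinity, and a convergent sequence is bounded. At integers in
  -- the spectrum `resolvent` takes the default value `0`, so the bound covers every `k`.
  have h2 := (spectrum.resolvent_tendsto_cobounded (𝕜 := ℂ) T).comp h1
  obtain ⟨C, hC⟩ := (Metric.isBounded_range_of_tendsto _ h2).exists_norm_le
  exact ⟨max C 1, by positivity, fun k => (hC _ ⟨k, rfl⟩).trans (le_max_left _ _)⟩

/-- The product of a power series of operators with a power series of vectors, as the
multilinear map `(v, w) ↦ p v (q w)`. -/
noncomputable def opMulCoeff {V E : Type*} [NormedAddCommGroup V] [NormedSpace ℂ V]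
    [NormedAddCommGroup E] [NormedSpace ℂ E] {j l k : ℕ} (h : j + l = k)
    (p : V [×j]→L[ℂ] (E →L[ℂ] E)) (q : V [×l]→L[ℂ] E) : V [×k]→L[ℂ] E :=
  (((ContinuousLinearMap.compContinuousMultilinearMapL ℂ (fun _ : Fin l => V) E E).flip
    q).compContinuousMultilinearMap p).uncurrySum.domDomCongr (finSumFinEquiv.trans (finCongr h))

theorem opMulCoeff_apply_diag {V E : Type*} [NormedAddCommGroup V] [NormedSpace ℂ V]
    [NormedAddCommGroup E] [NormedSpace ℂ E] {j l k : ℕ} (h : j + l = k)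
    (p : V [×j]→L[ℂ] (E →L[ℂ] E)) (q : V [×l]→L[ℂ] E) (z : V) :
    opMulCoeff h p q (fun _ => z) = p (fun _ => z) (q fun _ => z) := by

  rfl

theorem norm_opMulCoeff_le {V E : Type*} [NormedAddCommGroup V] [NormedSpace ℂ V]
    [NormedAddCommGroup E] [NormedSpace ℂ E] {j l k : ℕ} (h : j + l = k)
    (p : V [×j]→L[ℂ] (E →L[ℂ] E)) (q : V [×l]→L[ℂ] E) :
    ‖opMulCoeff h p q‖ ≤ ‖p‖ * ‖q‖ := by
  subst h
  refine ContinuousMultilinearMap.opNorm_le_bound (by positivity) fun m => ?_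
  have : opMulCoeff rfl p q m
      = p (fun i => m (Fin.castAdd l i)) (q fun i => m (Fin.natAdd j i)) := rfl
  rw [this, Fin.prod_univ_add]
  calc _ ≤ ‖p fun i => m (Fin.castAdd l i)‖ * ‖q fun i => m (Fin.natAdd j i)‖ :=
        ContinuousLinearMap.le_opNorm _ _
    _ ≤ (‖p‖ * ∏ i, ‖m (Fin.castAdd l i)‖) * (‖q‖ * ∏ i, ‖m (Fin.natAdd j i)‖) := by
        gcongr
        · exact p.le_opNorm _
        · exact q.le_opNorm _
    _ = _ := by ring

/-- The Cauchy product of a series of operators and a series of vectors. -/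
theorem hasSum_sum_antidiagonal_clm_apply {E : Type*} [NormedAddCommGroup E] [NormedSpace ℂ E]
    [CompleteSpace E] {f : ℕ → E →L[ℂ] E} {g : ℕ → E} {a : E →L[ℂ] E} {b : E}
    (hf : HasSum f a) (hg : HasSum g b) (hf' : Summable fun n => ‖f n‖)
    (hg' : Summable fun n => ‖g n‖) :
    HasSum (fun n => ∑ kl ∈ Finset.HasAntidiagonal.antidiagonal n, f kl.1 (g kl.2)) (a b) := by
  have hs : Summable fun x : ℕ × ℕ => f x.1 (g x.2) :=
    Summable.of_norm_bounded
      (hf'.mul_of_nonneg hg' (fun _ => norm_nonneg _) fun _ => norm_nonneg _)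
      fun x => (f x.1).le_opNorm _
  have h1 : HasSum (fun x : ℕ × ℕ => f x.1 (g x.2)) (a b) := by
    have h2 := hs.hasSum.prod_fiberwise fun i => (f i).hasSum hg
    have h3 : HasSum (fun i => f i b) (a b) :=
      (ContinuousLinearMap.apply ℂ E b).hasSum hf
    rw [h3.unique h2]
    exact hs.hasSum
  have h4 := (Finset.HasAntidiagonal.sigmaAntidiagonalEquivProd (A := ℕ)).hasSum_iff.2 h1
  refine h4.sigma fun n => ?_
  have := hasSum_fintype fun c : Finset.HasAntidiagonal.antidiagonal n => f (c : ℕ × ℕ).1 (g (c : ℕ × ℕ).2)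
  rwa [Finset.sum_coe_sort (Finset.HasAntidiagonal.antidiagonal n) (fun kl => f kl.1 (g kl.2))] at this

/-- The coefficients of the power series solution of the Euler-type equation with coefficient
`p` and initial value `v`, where `S k` stands for `(k - p 0)⁻¹`. -/
noncomputable def eulerSeries {V E : Type*} [NormedAddCommGroup V] [NormedSpace ℂ V]
    [NormedAddCommGroup E] [NormedSpace ℂ E] (p : FormalMultilinearSeries ℂ V (E →L[ℂ] E))
    (S : ℕ → E →L[ℂ] E) (v : E) : (k : ℕ) → V [×k]→L[ℂ] E
  | 0 => ContinuousMultilinearMap.uncurry0 ℂ V v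
  | k + 1 => (S (k + 1)).compContinuousMultilinearMap
      (∑ j : Fin (k + 1), opMulCoeff (j := (j : ℕ) + 1) (l := k - j) (by omega) (p (j + 1))
        (eulerSeries p S v (k - j)))

theorem eulerSeries_succ_apply_diag {V E : Type*} [NormedAddCommGroup V] [NormedSpace ℂ V]
    [NormedAddCommGroup E] [NormedSpace ℂ E] (p : FormalMultilinearSeries ℂ V (E →L[ℂ] E))
    (S : ℕ → E →L[ℂ] E) (v : E) (k : ℕ) (z : V) :
    eulerSeries p S v (k + 1) (fun _ => z) = S (k + 1) (∑ j ∈ Finset.range (k + 1),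
      p (j + 1) (fun _ => z) (eulerSeries p S v (k - j) fun _ => z)) := by
  rw [eulerSeries, ContinuousLinearMap.compContinuousMultilinearMap_coe, Function.comp_apply,
    sum_apply, Finset.sum_range]
  simp only [opMulCoeff_apply_diag]

/-- The ratio `ρ = a (1 + C A)` is chosen so that `ρ - a = a C A` is the constant in front of the
convolution `∑ aʲ ρ^(k-j)` produced by the recursion; that sum then telescopes to `ρ^(k+1) -
a^(k+1)`, and the induction closes. -/
theorem norm_eulerSeries_le {V E : Type*} [NormedAddCommGroup V] [NormedSpace ℂ V]
    [NormedAddCommGroup E] [NormedSpace ℂ E] (p : FormalMultilinearSeries ℂ V (E →L[ℂ] E))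
    (S : ℕ → E →L[ℂ] E) (v : E) {A a C : ℝ} (hA : 0 ≤ A) (ha : 0 ≤ a) (hC : 0 ≤ C)
    (hp : ∀ j, ‖p j‖ ≤ A * a ^ j) (hS : ∀ k, ‖S k‖ ≤ C) (k : ℕ) :
    ‖eulerSeries p S v k‖ ≤ ‖v‖ * (a * (1 + C * A)) ^ k := by
  induction k using Nat.strong_induction_on with
  | _ k ih =>
  rcases k with _ | k
  · rw [eulerSeries]
    simp
  set ρ := a * (1 + C * A) with hρ
  have hρ0 : 0 ≤ ρ := by positivity
  have hgeom : (∑ j ∈ Finset.range (k + 1), ρ ^ j * a ^ (k - j)) * (ρ - a)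
      = ρ ^ (k + 1) - a ^ (k + 1) := by
    have := geom_sum₂_mul ρ a (k + 1)
    simpa using this
  have hflip : ∑ j ∈ Finset.range (k + 1), a ^ j * ρ ^ (k - j)
      = ∑ j ∈ Finset.range (k + 1), ρ ^ j * a ^ (k - j) := by
    rw [← Finset.sum_range_reflect]
    refine Finset.sum_congr rfl fun j hj => ?_
    have : j ≤ k := Nat.lt_succ_iff.1 (Finset.mem_range.1 hj)
    have h1 : k + 1 - 1 - j = k - j := by omega
    have h2 : k - (k - j) = j := by omega
    rw [h1, h2, mul_comm]
  rw [eulerSeries]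
  calc _ ≤ ‖S (k + 1)‖ * ‖∑ j : Fin (k + 1), opMulCoeff (j := (j : ℕ) + 1) (l := k - j)
          (by omega) (p (j + 1)) (eulerSeries p S v (k - j))‖ :=
        ContinuousLinearMap.norm_compContinuousMultilinearMap_le _ _
    _ ≤ C * ∑ j : Fin (k + 1), (A * a ^ ((j : ℕ) + 1)) * (‖v‖ * ρ ^ (k - (j : ℕ))) := by
        gcongr
        · exact hS _
        · refine (norm_sum_le _ _).trans (Finset.sum_le_sum fun j _ => ?_)
          refine (norm_opMulCoeff_le _ _ _).trans ?_
          gcongr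
          · exact hp _
          · exact ih _ (by omega)
    _ = ‖v‖ * ((∑ j ∈ Finset.range (k + 1), a ^ j * ρ ^ (k - j)) * (ρ - a)) := by
        rw [Fin.sum_univ_eq_sum_range (fun j => (A * a ^ (j + 1)) * (‖v‖ * ρ ^ (k - j))),
          Finset.sum_mul, Finset.mul_sum, Finset.mul_sum]
        refine Finset.sum_congr rfl fun j _ => ?_
        rw [hρ]; ring
    _ = ‖v‖ * (ρ ^ (k + 1) - a ^ (k + 1)) := by rw [hflip, hgeom]
    _ ≤ ‖v‖ * ρ ^ (k + 1) := by
        gcongr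
        exact sub_le_self _ (by positivity)

/-- Existence of an analytic solution of the Euler-type equation `∑ zᵢ ∂ᵢ Y = M Y` with initial
value in the kernel of `M 0`, provided no positive integer lies in the spectrum of `M 0`. -/
theorem exists_analyticAt_euler {V E : Type*} [NormedAddCommGroup V] [NormedSpace ℂ V]
    [NormedAddCommGroup E] [NormedSpace ℂ E] [CompleteSpace E] {M : V → E →L[ℂ] E}
    (hM : AnalyticAt ℂ M 0) (hk : ∀ k : ℕ, 1 ≤ k → (k : ℂ) ∉ spectrum ℂ (M 0)) {v : E}
    (hv : M 0 v = 0) :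
    ∃ Y : V → E, AnalyticAt ℂ Y 0 ∧ Y 0 = v ∧
      ∀ᶠ z in 𝓝 (0 : V), fderiv ℂ Y z z = M z (Y z) := by
  obtain ⟨p, hp⟩ := hM
  obtain ⟨R, hpR⟩ := hp
  obtain ⟨C, hC0, hC⟩ := exists_bound_resolvent_nat (M 0)
  obtain ⟨r, hr0, hr⟩ := ENNReal.lt_iff_exists_nnreal_btwn.1 (hpR.r_pos.trans_le hpR.r_le)
  obtain ⟨A, hA0, hA⟩ := p.norm_mul_pow_le_of_lt_radius hr
  have hr0' : (0 : ℝ) < r := by exact_mod_cast hr0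
  set S : ℕ → E →L[ℂ] E := fun k => resolvent (M 0) (k : ℂ) with hS
  set q : FormalMultilinearSeries ℂ V E := eulerSeries p S v with hq
  have hpbound : ∀ j, ‖p j‖ ≤ A * ((r : ℝ)⁻¹) ^ j := fun j => by
    rw [inv_pow, ← div_eq_mul_inv, le_div_iff₀ (by positivity)]
    exact hA j
  have hqbound := norm_eulerSeries_le p S v hA0.le (inv_nonneg.2 hr0'.le) hC0.le hpbound hC
  have hρ : 0 < (r : ℝ)⁻¹ * (1 + C * A) := by positivity
  have hqr : 0 < q.radius := by
    have := q.le_radius_of_bound ‖v‖ (r := Real.toNNReal ((r : ℝ)⁻¹ * (1 + C * A))⁻¹)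
      (fun n => by
        refine (mul_le_mul_of_nonneg_right (hqbound n) (by positivity)).trans ?_
        rw [Real.coe_toNNReal _ (inv_nonneg.2 hρ.le), mul_assoc, ← mul_pow,
          mul_inv_cancel₀ hρ.ne', one_pow, mul_one])
    refine lt_of_lt_of_le ?_ this
    rw [ENNReal.coe_pos, Real.toNNReal_pos]
    exact inv_pos.2 hρ
  have hY := q.hasFPowerSeriesOnBall hqr
  have hq0 : ∀ z : V, q 0 (fun _ => z) = v := fun z => by
    rw [hq, eulerSeries]; simp
  have hp0 : ∀ z : V, p 0 (fun _ => z) = M 0 := fun z => hpR.coeff_zero _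
  refine ⟨q.sum, hY.analyticAt, ?_, ?_⟩
  · rw [← hY.coeff_zero (fun _ => 0), hq0]
  have hmem : ∀ᶠ z in 𝓝 (0 : V), z ∈ Metric.eball (0 : V) R ∧ z ∈ Metric.eball (0 : V) q.radius :=
    Filter.inter_mem (Metric.eball_mem_nhds _ hpR.r_pos) (Metric.eball_mem_nhds _ hqr)
  filter_upwards [hmem] with z ⟨hz1, hz2⟩
  have hs1 := hpR.hasSum hz1
  have hs2 := hY.hasSum hz2
  rw [zero_add] at hs1 hs2
  have hprod := hasSum_sum_antidiagonal_clm_apply hs1 hs2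
    (p.summable_norm_apply (Metric.eball_subset_eball hpR.r_le hz1)) (q.summable_norm_apply hz2)
  have hder : HasSum (fun n : ℕ => (n + 1) • q (n + 1) fun _ => z) (fderiv ℂ q.sum z z) := by
    have := (ContinuousLinearMap.apply ℂ E z).hasSum (hY.fderiv.hasSum hz2)
    simpa [FormalMultilinearSeries.derivSeries_apply_diag] using this
  have hder' : HasSum (fun n : ℕ => n • q n fun _ => z) (fderiv ℂ q.sum z z) := by
    rw [← hasSum_nat_add_iff' 1]
    simpa using hder
  refine HasSum.unique ?_ hprod
  -- Comparison by degree: the Euler field multiplies the degree `n` term by `n`. Degree `0` needs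
  -- `M 0 v = 0`; in higher degree, moving the `p 0` term of the Cauchy product across leaves the
  -- defining recursion.
  convert hder' using 2 with n
  rcases n with _ | n
  · simp [hq0, hp0, hv]
  rw [Finset.Nat.sum_antidiagonal_eq_sum_range_succ
    (fun i j => p i (fun _ => z) (q j fun _ => z)), Finset.sum_range_succ', hp0]
  have hu : IsUnit (algebraMap ℂ (E →L[ℂ] E) ((n + 1 : ℕ) : ℂ) - M 0) :=
    spectrum.notMem_iff.1 (hk (n + 1) (by omega))
  have hrec : (algebraMap ℂ (E →L[ℂ] E) ((n + 1 : ℕ) : ℂ) - M 0) (q (n + 1) fun _ => z)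
      = ∑ j ∈ Finset.range (n + 1), p (j + 1) (fun _ => z) (q (n - j) fun _ => z) := by
    rw [hq, eulerSeries_succ_apply_diag, ← mul_apply_eq_comp, hS]
    simp only [resolvent]
    rw [Ring.mul_inverse_cancel _ hu]
    simp
  have hidx : ∀ i j : ℕ, i = j → q i (fun _ => z) = q j fun _ => z := by
    rintro i _ rfl
    rfl
  have hsub : ∑ j ∈ Finset.range (n + 1),
      p (j + 1) (fun _ => z) (q (n + 1 - (j + 1)) fun _ => z)
      = ∑ j ∈ Finset.range (n + 1), p (j + 1) (fun _ => z) (q (n - j) fun _ => z) :=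
    Finset.sum_congr rfl fun j _ => by rw [hidx (n + 1 - (j + 1)) (n - j) (by omega)]
  refine (congrArg₂ (· + ·) (hsub.trans hrec.symm) rfl).trans ?_
  simp [Algebra.algebraMap_eq_smul_one, ← Nat.cast_smul_eq_nsmul ℂ]

/-! ### Calculus of the logarithmic vector fields. -/

/-- The coefficient of `∂ᵢ` in the logarithmic vector field `z₁ ∂₁, ∂₂, …, ∂_m`. -/
noncomputable def logWeight {d : ℕ} (i : Fin (d + 1)) (z : Fin (d + 1) → ℂ) : ℂ :=
  if i = 0 then z 0 else 1

/-- The coefficients `1, z₂, …, z_m` that express the Euler field `∑ zᵢ ∂ᵢ` in terms of the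
logarithmic vector fields. -/
noncomputable def eulerWeight {d : ℕ} (i : Fin (d + 1)) (z : Fin (d + 1) → ℂ) : ℂ :=
  if i = 0 then 1 else z i

/-- The derivative along the logarithmic vector fields `z₁ ∂₁, ∂₂, …, ∂_m`. -/
noncomputable def logPartialDeriv {d : ℕ} {F : Type*} [NormedAddCommGroup F] [NormedSpace ℂ F]
    (i : Fin (d + 1)) (f : (Fin (d + 1) → ℂ) → F) (z : Fin (d + 1) → ℂ) : F :=
  logWeight i z • partialDeriv i f z

section LogPartialDeriv

variable {d : ℕ} {F : Type*} [NormedAddCommGroup F] [NormedSpace ℂ F]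

theorem analyticAt_logWeight (i : Fin (d + 1)) (z : Fin (d + 1) → ℂ) :
    AnalyticAt ℂ (logWeight i) z := by
  unfold logWeight
  split_ifs
  · exact (ContinuousLinearMap.proj (R := ℂ) (φ := fun _ : Fin (d + 1) => ℂ) 0).analyticAt z
  · exact analyticAt_const

theorem analyticAt_eulerWeight (i : Fin (d + 1)) (z : Fin (d + 1) → ℂ) :
    AnalyticAt ℂ (eulerWeight i) z := by
  unfold eulerWeight
  split_ifs
  · exact analyticAt_const
  · exact (ContinuousLinearMap.proj (R := ℂ) (φ := fun _ : Fin (d + 1) => ℂ) i).analyticAt z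

theorem AnalyticAt.clm_apply {V G : Type*} [NormedAddCommGroup V] [NormedSpace ℂ V]
    [NormedAddCommGroup G] [NormedSpace ℂ G] {A : V → G →L[ℂ] F} {f : V → G} {z : V}
    (hA : AnalyticAt ℂ A z) (hf : AnalyticAt ℂ f z) : AnalyticAt ℂ (fun w => A w (f w)) z :=
  ((ContinuousLinearMap.id ℂ (G →L[ℂ] F)).analyticAt_bilinear (A z, f z)).comp₂ hA hf

theorem AnalyticAt.partialDeriv [CompleteSpace F] {n : ℕ} {f : (Fin n → ℂ) → F} {z : Fin n → ℂ}
    (hf : AnalyticAt ℂ f z) (i : Fin n) : AnalyticAt ℂ (partialDeriv i f) z :=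
  hf.fderiv.clm_apply analyticAt_const

theorem AnalyticAt.logPartialDeriv [CompleteSpace F] {f : (Fin (d + 1) → ℂ) → F} {z : Fin (d + 1) → ℂ}
    (hf : AnalyticAt ℂ f z) (i : Fin (d + 1)) : AnalyticAt ℂ (logPartialDeriv i f) z :=
  (analyticAt_logWeight i z).smul (hf.partialDeriv i)

theorem fderiv_apply_eq_sum_partialDeriv {n : ℕ} (f : (Fin n → ℂ) → F) (z v : Fin n → ℂ) :
    fderiv ℂ f z v = ∑ i, v i • partialDeriv i f z :=
  LinearMap.pi_apply_eq_sum_univ (fderiv ℂ f z).toLinearMap v |>.trans <| by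
    refine Finset.sum_congr rfl fun i _ => ?_
    refine congrArg (fun u => v i • fderiv ℂ f z u) ?_
    ext j
    simp [Pi.single_apply, eq_comm]

theorem eulerWeight_mul_logWeight (i : Fin (d + 1)) (z : Fin (d + 1) → ℂ) :
    eulerWeight i z * logWeight i z = z i := by
  unfold eulerWeight logWeight
  split_ifs with h <;> simp [h]

theorem fderiv_apply_self_eq_sum_logPartialDeriv (f : (Fin (d + 1) → ℂ) → F) (z : Fin (d + 1) → ℂ) :
    fderiv ℂ f z z = ∑ i, eulerWeight i z • logPartialDeriv i f z := by
  rw [fderiv_apply_eq_sum_partialDeriv]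
  refine Finset.sum_congr rfl fun i _ => ?_
  rw [logPartialDeriv, smul_smul, eulerWeight_mul_logWeight]

theorem Filter.EventuallyEq.logPartialDeriv_eq {f g : (Fin (d + 1) → ℂ) → F} {z : Fin (d + 1) → ℂ}
    (h : f =ᶠ[𝓝 z] g) (i : Fin (d + 1)) : logPartialDeriv i f z = logPartialDeriv i g z := by
  rw [logPartialDeriv, logPartialDeriv, partialDeriv, partialDeriv, h.fderiv_eq]

theorem logPartialDeriv_sub {f g : (Fin (d + 1) → ℂ) → F} {z : Fin (d + 1) → ℂ}
    (hf : DifferentiableAt ℂ f z) (hg : DifferentiableAt ℂ g z) (i : Fin (d + 1)) :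
    logPartialDeriv i (fun w => f w - g w) z = logPartialDeriv i f z - logPartialDeriv i g z := by
  simp only [logPartialDeriv, partialDeriv, fderiv_fun_sub hf hg, sub_apply, smul_sub]

theorem logPartialDeriv_clm_apply {A : (Fin (d + 1) → ℂ) → F →L[ℂ] F} {f : (Fin (d + 1) → ℂ) → F}
    {z : Fin (d + 1) → ℂ} (hA : DifferentiableAt ℂ A z) (hf : DifferentiableAt ℂ f z)
    (i : Fin (d + 1)) :
    logPartialDeriv i (fun w => A w (f w)) z = logPartialDeriv i A z (f z) + A z (logPartialDeriv i f z) := by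
  simp [logPartialDeriv, partialDeriv, fderiv_clm_apply hA hf, smul_add, add_comm]

theorem logPartialDeriv_smul {a : (Fin (d + 1) → ℂ) → ℂ} {f : (Fin (d + 1) → ℂ) → F}
    {z : Fin (d + 1) → ℂ} (ha : DifferentiableAt ℂ a z) (hf : DifferentiableAt ℂ f z)
    (i : Fin (d + 1)) :
    logPartialDeriv i (fun w => a w • f w) z = logPartialDeriv i a z • f z + a z • logPartialDeriv i f z := by
  simp only [logPartialDeriv, partialDeriv, fderiv_fun_smul ha hf]
  simp [smul_add, smul_smul, add_comm, mul_comm]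

theorem logPartialDeriv_eulerWeight (i j : Fin (d + 1)) (z : Fin (d + 1) → ℂ) :
    logPartialDeriv i (eulerWeight j) z = if i = j ∧ j ≠ 0 then 1 else 0 := by
  unfold eulerWeight
  by_cases hj : j = 0
  · simp [logPartialDeriv, partialDeriv, hj]
  · have : fderiv ℂ (fun w : Fin (d + 1) → ℂ => w j) z
        = ContinuousLinearMap.proj (R := ℂ) (φ := fun _ : Fin (d + 1) => ℂ) j :=
      (ContinuousLinearMap.proj (R := ℂ) (φ := fun _ : Fin (d + 1) => ℂ) j).fderiv
    simp only [hj, logPartialDeriv, partialDeriv, if_false, this]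
    by_cases hij : i = j
    · subst hij
      simp [hj, logWeight]
    · simp [hij, Ne.symm hij]

theorem logPartialDeriv_logWeight_of_ne {i j : Fin (d + 1)} (h : i ≠ j) (z : Fin (d + 1) → ℂ) :
    logPartialDeriv i (logWeight j) z = 0 := by
  unfold logWeight
  by_cases hj : j = 0
  · have : fderiv ℂ (fun w : Fin (d + 1) → ℂ => w 0) z
        = ContinuousLinearMap.proj (R := ℂ) (φ := fun _ : Fin (d + 1) => ℂ) 0 :=
      (ContinuousLinearMap.proj (R := ℂ) (φ := fun _ : Fin (d + 1) => ℂ) 0).fderiv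
    subst hj
    simp [logPartialDeriv, partialDeriv, this, Ne.symm h]
  · simp [logPartialDeriv, partialDeriv, hj]

/-- Each weight is annihilated by the fields of other indices, so only the symmetric second
derivative remains. -/
theorem logPartialDeriv_comm [CompleteSpace F] {f : (Fin (d + 1) → ℂ) → F} {z : Fin (d + 1) → ℂ}
    (hf : AnalyticAt ℂ f z) (i j : Fin (d + 1)) :
    logPartialDeriv i (logPartialDeriv j f) z = logPartialDeriv j (logPartialDeriv i f) z := by
  by_cases h : i = j
  · rw [h]
  have hsymm : IsSymmSndFDerivAt ℂ f z :=
    hf.contDiffAt.isSymmSndFDerivAt_of_omega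
  have hpp : ∀ k l : Fin (d + 1), partialDeriv k (partialDeriv l f) z
      = fderiv ℂ (fderiv ℂ f) z (Pi.single k 1) (Pi.single l 1) := fun k l => by
    have : partialDeriv l f = fun w => fderiv ℂ f w (Pi.single l 1) := rfl
    rw [this, partialDeriv,
      fderiv_clm_apply hf.fderiv.differentiableAt (differentiableAt_const _)]
    simp
  have key : ∀ k l : Fin (d + 1), k ≠ l → logPartialDeriv k (logPartialDeriv l f) z
      = (logWeight l z * logWeight k z) •
        fderiv ℂ (fderiv ℂ f) z (Pi.single k 1) (Pi.single l 1) := fun k l hkl => by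
    have : logPartialDeriv l f = fun w => logWeight l w • partialDeriv l f w := rfl
    rw [this, logPartialDeriv_smul (analyticAt_logWeight l z).differentiableAt
      (hf.partialDeriv l).differentiableAt, logPartialDeriv_logWeight_of_ne hkl, zero_smul, zero_add,
      logPartialDeriv, hpp, smul_smul]
  rw [key i j h, key j i (Ne.symm h), hsymm.eq, mul_comm]

theorem sum_eulerWeight_zero (Q : Fin (d + 1) → (Fin (d + 1) → ℂ) → F →L[ℂ] F) :
    ∑ i, eulerWeight i (0 : Fin (d + 1) → ℂ) • Q i 0 = Q 0 0 := by
  rw [Finset.sum_eq_single 0]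
  · simp [eulerWeight]
  · intro i _ hi
    simp [eulerWeight, hi]
  · simp

end LogPartialDeriv

/-! ### Holomorphic solutions of integrable logarithmic systems. -/

section LogSystem

variable {d : ℕ} {E : Type*} [NormedAddCommGroup E] [NormedSpace ℂ E] [CompleteSpace E]

/-- If `Y` solves the Euler equation of an integrable logarithmic system, then the defects
`δᵢ Y - Qᵢ Y` solve Euler-type equations themselves. -/
theorem fderiv_defect {Q : Fin (d + 1) → (Fin (d + 1) → ℂ) → E →L[ℂ] E}
    (hQ : ∀ i, AnalyticAt ℂ (Q i) 0)
    (hflat : ∀ᶠ z in 𝓝 0, ∀ i j, logPartialDeriv i (Q j) z - logPartialDeriv j (Q i) z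
      = Q i z * Q j z - Q j z * Q i z)
    {Y : (Fin (d + 1) → ℂ) → E} (hY : AnalyticAt ℂ Y 0)
    (hE : ∀ᶠ z in 𝓝 0, fderiv ℂ Y z z = ∑ i, eulerWeight i z • Q i z (Y z)) (b : Fin (d + 1)) :
    ∀ᶠ z in 𝓝 0, fderiv ℂ (fun w => logPartialDeriv b Y w - Q b w (Y w)) z z
      = (∑ i, eulerWeight i z • Q i z) (logPartialDeriv b Y z - Q b z (Y z))
        - if b = 0 then 0 else logPartialDeriv b Y z - Q b z (Y z) := by
  set R : Fin (d + 1) → (Fin (d + 1) → ℂ) → E := fun i w => logPartialDeriv i Y w - Q i w (Y w) with hR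
  -- The Euler equation says exactly that this weighted sum of the defects vanishes.
  have hsum0 : ∀ᶠ z in 𝓝 0, ∑ i, eulerWeight i z • R i z = 0 := by
    filter_upwards [hE] with z hz
    simp only [hR, smul_sub, Finset.sum_sub_distrib]
    rw [← fderiv_apply_self_eq_sum_logPartialDeriv, hz, sub_self]
  filter_upwards [hsum0.eventually_nhds, hflat, hY.eventually_analyticAt,
    eventually_all.2 fun i => (hQ i).eventually_analyticAt] with z hs hf hYz hQz
  have hRz : ∀ i, AnalyticAt ℂ (R i) z := fun i =>
    (hYz.logPartialDeriv i).sub ((hQz i).clm_apply hYz)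
  have hdR : ∀ i j, logPartialDeriv i (R j) z = logPartialDeriv i (logPartialDeriv j Y) z
      - (logPartialDeriv i (Q j) z (Y z) + Q j z (logPartialDeriv i Y z)) := fun i j => by
    rw [hR, logPartialDeriv_sub (hYz.logPartialDeriv j).differentiableAt
      ((hQz j).clm_apply hYz).differentiableAt,
      logPartialDeriv_clm_apply (hQz j).differentiableAt hYz.differentiableAt]
  -- Commuting fields and flatness allow the indices `i` and `b` to be exchanged at the cost of
  -- terms linear in the defects.
  have hcomm : ∀ i, logPartialDeriv i (R b) z = logPartialDeriv b (R i) z + Q i z (R b z) - Q b z (R i z) := by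
    intro i
    have h1 := congrArg (fun T : E →L[ℂ] E => T (Y z)) (hf i b)
    simp only [sub_apply, mul_apply_eq_comp] at h1
    rw [hdR, hdR, logPartialDeriv_comm hYz i b, eq_add_of_sub_eq h1]
    simp only [hR, map_sub]
    abel
  -- Differentiate the weighted sum along the field of index `b`. Only the weight `z_b` with `b ≠ 0`
  -- contributes a derivative, which is the source of the extra `-R b`.
  have hds : ∑ i, ((if b = i ∧ i ≠ 0 then (1 : ℂ) else 0) • R i z
      + eulerWeight i z • logPartialDeriv b (R i) z) = 0 := by
    have h1 : logPartialDeriv b (fun w => ∑ i, eulerWeight i w • R i w) z = 0 := by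
      rw [Filter.EventuallyEq.logPartialDeriv_eq (g := fun _ => 0) hs]
      simp [logPartialDeriv, partialDeriv]
    rw [← h1]
    have h2 : logPartialDeriv b (fun w => ∑ i, eulerWeight i w • R i w) z
        = ∑ i, logPartialDeriv b (fun w => eulerWeight i w • R i w) z := by
      simp only [logPartialDeriv, partialDeriv]
      rw [fderiv_fun_sum (A := fun i w => eulerWeight i w • R i w) fun i _ =>
        ((analyticAt_eulerWeight i z).smul (hRz i)).differentiableAt]
      simp [Finset.smul_sum]
    rw [h2]
    refine Finset.sum_congr rfl fun i _ => ?_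
    rw [logPartialDeriv_smul (analyticAt_eulerWeight i z).differentiableAt (hRz i).differentiableAt,
      logPartialDeriv_eulerWeight]
  have hfirst : ∑ i, (if b = i ∧ i ≠ 0 then (1 : ℂ) else 0) • R i z
      = if b = 0 then 0 else R b z := by
    rw [Finset.sum_eq_single b]
    · by_cases hb : b = 0 <;> simp [hb]
    · intro i _ hi
      simp [Ne.symm hi]
    · simp
  rw [Finset.sum_add_distrib, hfirst] at hds
  change fderiv ℂ (R b) z z = (∑ i, eulerWeight i z • Q i z) (R b z) - if b = 0 then 0 else R b z
  rw [fderiv_apply_self_eq_sum_logPartialDeriv]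
  have hsz : ∑ i, eulerWeight i z • Q b z (R i z) = 0 := by
    have := congrArg (Q b z) hs.self_of_nhds
    simpa using this
  simp only [hcomm, smul_sub, smul_add, Finset.sum_sub_distrib, Finset.sum_add_distrib]
  rw [hsz, eq_neg_of_add_eq_zero_right hds]
  simp only [_root_.sum_apply, smul_apply]
  abel

/-- The spectral condition in terms of eigenvectors. -/
theorem eq_zero_of_natCast_notMem_spectrum {T : E →L[ℂ] E} {k : ℂ}
    (hk : k ∉ spectrum ℂ T) {v : E} (hv : T v = k • v) : v = 0 := by
  have hu := ContinuousLinearMap.isUnit_iff_bijective.1 (spectrum.notMem_iff.1 hk)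
  refine hu.1 ?_
  simp [Algebra.algebraMap_eq_smul_one, hv]

/-- Uniqueness of holomorphic solutions of a logarithmic system with given value at the origin. -/
theorem logSystem_unique {Q : Fin (d + 1) → (Fin (d + 1) → ℂ) → E →L[ℂ] E}
    (hQ : ∀ i, AnalyticAt ℂ (Q i) 0) (hk : ∀ k : ℕ, 1 ≤ k → (k : ℂ) ∉ spectrum ℂ (Q 0 0))
    {Y : (Fin (d + 1) → ℂ) → E} (hY : AnalyticAt ℂ Y 0)
    (hsol : ∀ᶠ z in 𝓝 0, ∀ i, logPartialDeriv i Y z = Q i z (Y z)) (h0 : Y 0 = 0) :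
    ∀ᶠ z in 𝓝 0, Y z = 0 := by
  refine eventually_eq_zero_of_euler (A := fun z => ∑ i, eulerWeight i z • Q i z) hY ?_ ?_ h0 ?_
  · exact (Finset.univ.analyticAt_fun_sum fun i _ =>
      (analyticAt_eulerWeight i 0).smul (hQ i)).continuousAt
  · filter_upwards [hsol] with z hz
    rw [fderiv_apply_self_eq_sum_logPartialDeriv]
    simp [hz]
  · intro k hk1 v hv
    rw [sum_eulerWeight_zero] at hv
    exact eq_zero_of_natCast_notMem_spectrum (hk k hk1) hv

/-- Existence of holomorphic solutions of an integrable logarithmic system, with value at the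
origin prescribed in the kernel of the residue. -/
theorem exists_logSystem_solution {Q : Fin (d + 1) → (Fin (d + 1) → ℂ) → E →L[ℂ] E}
    (hQ : ∀ i, AnalyticAt ℂ (Q i) 0) (hk : ∀ k : ℕ, 1 ≤ k → (k : ℂ) ∉ spectrum ℂ (Q 0 0))
    (hflat : ∀ᶠ z in 𝓝 0, ∀ i j, logPartialDeriv i (Q j) z - logPartialDeriv j (Q i) z
      = Q i z * Q j z - Q j z * Q i z) {v : E} (hv : Q 0 0 v = 0) :
    ∃ Y : (Fin (d + 1) → ℂ) → E, AnalyticAt ℂ Y 0 ∧ Y 0 = v ∧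
      ∀ᶠ z in 𝓝 0, ∀ i, logPartialDeriv i Y z = Q i z (Y z) := by
  have hM : AnalyticAt ℂ (fun z => ∑ i, eulerWeight i z • Q i z) 0 :=
    Finset.univ.analyticAt_fun_sum fun i _ => (analyticAt_eulerWeight i 0).smul (hQ i)
  obtain ⟨Y, hY, hY0, hE⟩ := exists_analyticAt_euler hM
    (by simpa only [sum_eulerWeight_zero] using hk)
    (v := v) (by simpa only [sum_eulerWeight_zero] using hv)
  refine ⟨Y, hY, hY0, ?_⟩
  have hE' : ∀ᶠ z in 𝓝 0, fderiv ℂ Y z z = ∑ i, eulerWeight i z • Q i z (Y z) := by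
    filter_upwards [hE] with z hz
    simpa using hz
  refine eventually_all.2 fun b => ?_
  have hdef := fderiv_defect hQ hflat hY hE' b
  have hRb : AnalyticAt ℂ (fun w => logPartialDeriv b Y w - Q b w (Y w)) 0 :=
    (hY.logPartialDeriv b).sub ((hQ b).clm_apply hY)
  have hzero : ∀ᶠ z in 𝓝 0, logPartialDeriv b Y z - Q b z (Y z) = 0 := by
    by_cases hb : b = 0
    · refine eventually_eq_zero_of_euler hRb hM.continuousAt ?_ ?_ ?_
      · filter_upwards [hdef] with z hz
        rw [hz]
        simp [hb]
      · simp [hb, logPartialDeriv, logWeight, hY0, hv]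
      · intro k hk1 v hv
        rw [sum_eulerWeight_zero] at hv
        exact eq_zero_of_natCast_notMem_spectrum (hk k hk1) hv
    · refine eventually_eq_zero_of_euler (A := fun z => (∑ i, eulerWeight i z • Q i z) - 1) hRb
        (hM.continuousAt.sub continuousAt_const) ?_ ?_ ?_
      · filter_upwards [hdef] with z hz
        rw [hz]
        simp [hb]
      -- At the origin the defect equation reads `0 = (M 0 - 1) (R b 0)`, and `1` is not an
      -- eigenvalue of `M 0`, so `R b 0 = 0`.
      · have h1 := hdef.self_of_nhds
        rw [map_zero, sum_eulerWeight_zero, if_neg hb] at h1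
        exact eq_zero_of_natCast_notMem_spectrum (hk 1 le_rfl)
          (by rw [Nat.cast_one, one_smul]; exact sub_eq_zero.1 h1.symm)
      · intro k hk1 v hv
        rw [sum_eulerWeight_zero] at hv
        -- An eigenvalue `k` of `M 0 - 1` is an eigenvalue `k + 1` of `M 0`.
        refine eq_zero_of_natCast_notMem_spectrum (hk (k + 1) (by omega)) (v := v) ?_
        rw [sub_apply, sub_eq_iff_eq_add] at hv
        rw [hv]
        simp [add_smul]
  exact hzero.mono fun z hz => sub_eq_zero.1 hz

end LogSystem

/-! ### Uniqueness of the coefficients of a logarithmic expansion. -/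

/-- A function that is continuous near the origin and vanishes off `z₁ = 0` vanishes near the
origin. -/
theorem eventually_eq_zero_of_forall_ne {d : ℕ} {F : Type*} [NormedAddCommGroup F]
    {f : (Fin (d + 1) → ℂ) → F} (hf : ∀ᶠ z in 𝓝 0, ContinuousAt f z)
    (h : ∀ᶠ z in 𝓝 (0 : Fin (d + 1) → ℂ), z 0 ≠ 0 → f z = 0) : ∀ᶠ z in 𝓝 0, f z = 0 := by
  filter_upwards [hf, h.eventually_nhds] with z hz hz'
  by_cases h0 : z 0 = 0
  · have hc : ContinuousAt (fun t : ℂ => Function.update z 0 t) 0 :=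
      (continuous_const.update 0 continuous_id).continuousAt
    have hu : Function.update z 0 0 = z := by rw [← h0, Function.update_eq_self]
    have hc' : Tendsto (fun t : ℂ => Function.update z 0 t) (𝓝[≠] 0) (𝓝 z) := by
      have := hc.tendsto
      rw [hu] at this
      exact this.mono_left nhdsWithin_le_nhds
    refine tendsto_nhds_unique_of_eventuallyEq (hz.tendsto.comp hc') tendsto_const_nhds ?_
    filter_upwards [hc'.eventually hz', self_mem_nhdsWithin] with t ht ht0
    exact ht (by simpa using ht0)
  · exact hz'.self_of_nhds h0

theorem Complex.exp_mem_slitPlane_of_abs_im_lt {s : ℂ} (h : |s.im| < Real.pi) :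
    Complex.exp s ∈ Complex.slitPlane := by
  obtain ⟨h1, h2⟩ := abs_lt.1 h
  rw [Complex.mem_slitPlane_iff_arg]
  refine ⟨?_, Complex.exp_ne_zero s⟩
  rw [← Complex.log_im, Complex.log_exp h1 h2.le]
  exact h2.ne

/-- A polynomial with vector coefficients and infinitely many zeros vanishes. -/
theorem eq_zero_of_infinite_zeros {r N : ℕ} (v : Fin (N + 1) → Fin r → ℂ) {s : ℕ → ℂ}
    (hs : Function.Injective s) (h : ∀ k, ∑ n : Fin (N + 1), s k ^ (n : ℕ) • v n = 0) : v = 0 := by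
  ext n a
  set p : Polynomial ℂ := ∑ n : Fin (N + 1), Polynomial.C (v n a) * Polynomial.X ^ (n : ℕ) with hp
  have hp0 : p = 0 := by
    refine Polynomial.eq_zero_of_infinite_isRoot p ((Set.infinite_range_of_injective hs).mono ?_)
    rintro _ ⟨k, rfl⟩
    have := congrFun (h k) a
    simp only [Finset.sum_apply, Pi.smul_apply, smul_eq_mul, Pi.zero_apply] at this
    simp only [Set.mem_ofPred_eq, Polynomial.IsRoot, hp, Polynomial.eval_finsetSum,
      Polynomial.eval_mul, Polynomial.eval_C, Polynomial.eval_pow, Polynomial.eval_X]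
    rw [← this]
    exact Finset.sum_congr rfl fun n _ => mul_comm _ _
  have := congrArg (fun q => Polynomial.coeff q (n : ℕ)) hp0
  simpa [hp, Polynomial.finsetSum_coeff, Polynomial.coeff_C_mul, Polynomial.coeff_X_pow,
    Fin.val_inj] using this

/-- A logarithmic expansion that represents zero has zero coefficients. -/
theorem logExpansion_coeff_eq_zero {d r N : ℕ}
    {I : Fin (N + 1) → (Fin (d + 1) → ℂ) → (Fin r → ℂ)} (hI : ∀ n, AnalyticAt ℂ (I n) 0)
    (h : ∀ᶠ z in slitNhds d, logExpansion I z = 0) : ∀ᶠ z in 𝓝 0, ∀ n, I n z = 0 := by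
  have hIe : ∀ᶠ z in 𝓝 0, ∀ n, AnalyticAt ℂ (I n) z :=
    eventually_all.2 fun n => (hI n).eventually_analyticAt
  refine eventually_all.2 fun n => eventually_eq_zero_of_forall_ne
    (hIe.mono fun z hz => (hz n).continuousAt) ?_
  obtain ⟨ε, hε, hball⟩ := Metric.eventually_nhds_iff_ball.1
    (hIe.and (eventually_nhdsWithin_iff.1 h))
  filter_upwards [Metric.ball_mem_nhds 0 hε] with z hz hz0
  -- Substituting `z₁ = exp s` turns `log z₁` into `s`. The expansion becomes analytic on a whole
  -- half-plane and vanishes near a real point of it, hence everywhere there.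
  let γ : ℂ → Fin (d + 1) → ℂ := fun s => Function.update z 0 (Complex.exp s)
  let U : Set ℂ := {s | s.re < Real.log ε}
  have hγ : ∀ s ∈ U, γ s ∈ Metric.ball (0 : Fin (d + 1) → ℂ) ε := by
    intro s hs
    rw [mem_ball_zero_iff, pi_norm_lt_iff hε] at hz ⊢
    intro i
    by_cases hi : i = 0
    · subst hi
      simp only [γ, Function.update_self, Complex.norm_exp]
      exact (Real.lt_log_iff_exp_lt hε).1 hs
    · simpa [γ, Function.update_of_ne hi] using hz i
  have hγa : ∀ s, AnalyticAt ℂ γ s := fun s => by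
    refine analyticAt_pi_iff.2 fun i => ?_
    by_cases hi : i = 0
    · subst hi
      simpa [γ] using analyticAt_cexp
    · simpa [γ, Function.update_of_ne hi] using analyticAt_const
  have hF : AnalyticOnNhd ℂ (fun s => ∑ n : Fin (N + 1), s ^ (n : ℕ) • I n (γ s)) U := fun s hs =>
    Finset.univ.analyticAt_fun_sum fun n _ =>
      (analyticAt_id.pow _).smul (((hball _ (hγ s hs)).1 n).comp (hγa s))
  have hUconv : Convex ℝ U := (convex_Iio (Real.log ε)).linear_preimage Complex.reLm
  have hs0 : ((Real.log ε - 1 : ℝ) : ℂ) ∈ U := by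
    simp only [U, Set.mem_ofPred_eq, Complex.ofReal_re]
    linarith
  have hzero : (fun s => ∑ n : Fin (N + 1), s ^ (n : ℕ) • I n (γ s))
      =ᶠ[𝓝 ((Real.log ε - 1 : ℝ) : ℂ)] fun _ => 0 := by
    have hopen : ∀ᶠ s in 𝓝 ((Real.log ε - 1 : ℝ) : ℂ), s ∈ U ∧ |s.im| < Real.pi := by
      refine Filter.inter_mem
        ((isOpen_lt Complex.continuous_re continuous_const).mem_nhds hs0) ?_
      refine (isOpen_lt (continuous_abs.comp Complex.continuous_im)
        continuous_const).mem_nhds ?_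
      simp [Real.pi_pos]
    filter_upwards [hopen] with s ⟨hsU, hs⟩
    have h1 := (hball _ (hγ s hsU)).2
      (by simpa [γ] using Complex.exp_mem_slitPlane_of_abs_im_lt hs)
    obtain ⟨h2, h3⟩ := abs_lt.1 hs
    simpa [logExpansion, γ, Complex.log_exp h2 h3.le] using h1
  have hall := hF.eqOn_of_preconnected_of_eventuallyEq (fun _ _ => analyticAt_const)
    hUconv.isPreconnected hs0 hzero
  -- These are infinitely many logarithms of the same `z 0`: the coefficients agree at all of them,
  -- so a polynomial with fixed coefficients has infinitely many roots.
  let s : ℕ → ℂ := fun k => Complex.log (z 0) + k * (2 * Real.pi * Complex.I)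
  have hsinj : Function.Injective s := fun k l hkl => by
    have h1 := mul_right_cancel₀ Complex.two_pi_I_ne_zero (add_left_cancel hkl)
    exact_mod_cast h1
  have hexp : ∀ k, γ (s k) = z := fun k => by
    simp only [γ, s]
    rw [Complex.exp_add, Complex.exp_nat_mul_two_pi_mul_I, mul_one, Complex.exp_log hz0,
      Function.update_eq_self]
  have hsU : ∀ k, s k ∈ U := fun k => by
    have h1 : (s k).re = Real.log ‖z 0‖ := by simp [s, Complex.log_re]
    simp only [U, Set.mem_ofPred_eq, h1]
    rw [mem_ball_zero_iff] at hz
    exact Real.log_lt_log (norm_pos_iff.2 hz0) ((norm_le_pi_norm z 0).trans_lt hz)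
  have hv := eq_zero_of_infinite_zeros (fun n => I n z) hsinj fun k => by
    have := hall (hsU k)
    simpa only [hexp] using this
  exact congrFun hv n

theorem logExpansion_coeff_unique {d r N : ℕ}
    {I I' : Fin (N + 1) → (Fin (d + 1) → ℂ) → (Fin r → ℂ)} (hI : ∀ n, AnalyticAt ℂ (I n) 0)
    (hI' : ∀ n, AnalyticAt ℂ (I' n) 0) (h : logExpansion I =ᶠ[slitNhds d] logExpansion I')
    (n : Fin (N + 1)) : I n =ᶠ[𝓝 0] I' n := by
  have := logExpansion_coeff_eq_zero (I := fun n z => I n z - I' n z)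
    (fun n => (hI n).sub (hI' n)) (by
      filter_upwards [h] with z hz
      simp only [logExpansion, smul_sub, Finset.sum_sub_distrib] at hz ⊢
      rw [hz, sub_self])
  exact this.mono fun z hz => sub_eq_zero.1 (hz n)

/-! ### Linear algebra on tuples of coefficients. -/

section Operators

/-- A matrix acting on each member of a tuple of vectors. -/
noncomputable def tupleMulVec {r : ℕ} (N : ℕ) : Matrix (Fin r) (Fin r) ℂ →ₗ[ℂ]
    ((Fin (N + 1) → Fin r → ℂ) →L[ℂ] (Fin (N + 1) → Fin r → ℂ)) where
  toFun M := LinearMap.toContinuousLinearMap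
    { toFun := fun v n => M.mulVec (v n)
      map_add' := fun v w => by ext n : 1; simp [Matrix.mulVec_add]
      map_smul' := fun c v => by ext n : 1; simp [Matrix.mulVec_smul] }
  map_add' M M' := by ext v n : 2; simp [Matrix.add_mulVec]
  map_smul' c M := by ext v n : 2; simp [Matrix.smul_mulVec]

@[simp]
theorem tupleMulVec_apply {r N : ℕ} (M : Matrix (Fin r) (Fin r) ℂ) (v : Fin (N + 1) → Fin r → ℂ)
    (n : Fin (N + 1)) : tupleMulVec N M v n = M.mulVec (v n) := rfl

theorem tupleMulVec_mul {r N : ℕ} (M M' : Matrix (Fin r) (Fin r) ℂ) :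
    tupleMulVec N (M * M') = tupleMulVec N M * tupleMulVec N M' := by
  ext v n : 2
  simp

/-- The operator `(v₀, …, v_N) ↦ (v₁, 2 v₂, …, N v_N, 0)`, which is `d/dL` on `∑ Lⁿ vₙ`. -/
noncomputable def tupleShift (r N : ℕ) :
    (Fin (N + 1) → Fin r → ℂ) →L[ℂ] (Fin (N + 1) → Fin r → ℂ) :=
  LinearMap.toContinuousLinearMap
    { toFun := fun v => Fin.snoc (fun n : Fin N => (((n : ℕ) : ℂ) + 1) • v n.succ) 0
      map_add' := fun v w => by
        ext n : 1
        refine Fin.lastCases ?_ (fun n => ?_) n <;> simp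
      map_smul' := fun c v => by
        ext n : 1
        refine Fin.lastCases ?_ (fun n => ?_) n <;> simp [smul_comm c] }

@[simp]
theorem tupleShift_castSucc {r N : ℕ} (v : Fin (N + 1) → Fin r → ℂ) (n : Fin N) :
    tupleShift r N v n.castSucc = (((n : ℕ) : ℂ) + 1) • v n.succ :=
  Fin.snoc_castSucc (α := fun _ => Fin r → ℂ) 0
    (fun n : Fin N => (((n : ℕ) : ℂ) + 1) • v n.succ) n

@[simp]
theorem tupleShift_last {r N : ℕ} (v : Fin (N + 1) → Fin r → ℂ) :
    tupleShift r N v (Fin.last N) = 0 :=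
  Fin.snoc_last (α := fun _ => Fin r → ℂ) 0 (fun n : Fin N => (((n : ℕ) : ℂ) + 1) • v n.succ)

theorem tupleShift_mul_tupleMulVec {r N : ℕ} (M : Matrix (Fin r) (Fin r) ℂ) :
    tupleShift r N * tupleMulVec N M = tupleMulVec N M * tupleShift r N := by
  ext v n : 2
  refine Fin.lastCases ?_ (fun n => ?_) n <;> simp [Matrix.mulVec_smul]

/-- This identifies the shift with `d/dL`; the `n = 0` term on the right has coefficient `0`, so the
truncated exponent `n - 1` is harmless. -/
theorem sum_pow_smul_tupleShift {r N : ℕ} (L : ℂ) (v : Fin (N + 1) → Fin r → ℂ) :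
    ∑ n : Fin (N + 1), L ^ (n : ℕ) • tupleShift r N v n
      = ∑ n : Fin (N + 1), (((n : ℕ) : ℂ) * L ^ ((n : ℕ) - 1)) • v n := by
  rw [Fin.sum_univ_castSucc, Fin.sum_univ_succ]
  simp [smul_smul, mul_comm]

/-- Reduces analyticity and differentiation of matrix-valued functions to their scalar entries. -/
theorem tupleMulVec_eq_sum {r N : ℕ} (M : Matrix (Fin r) (Fin r) ℂ) :
    tupleMulVec N M = ∑ a, ∑ b, M a b • tupleMulVec N (Matrix.single a b 1) := by
  conv_lhs => rw [Matrix.matrix_eq_sum_single M]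
  simp only [map_sum, ← map_smul, Matrix.smul_single, smul_eq_mul, mul_one]

theorem analyticAt_tupleMulVec {r N : ℕ} {V : Type*} [NormedAddCommGroup V] [NormedSpace ℂ V]
    {M : V → Matrix (Fin r) (Fin r) ℂ} {z : V}
    (hM : ∀ a b, AnalyticAt ℂ (fun w => M w a b) z) :
    AnalyticAt ℂ (fun w => tupleMulVec N (M w)) z := by
  simp only [tupleMulVec_eq_sum (M _)]
  exact Finset.univ.analyticAt_fun_sum fun a _ => Finset.univ.analyticAt_fun_sum fun b _ =>
    (hM a b).smul analyticAt_const

theorem logPartialDeriv_tupleMulVec {d r N : ℕ}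
    {M : (Fin (d + 1) → ℂ) → Matrix (Fin r) (Fin r) ℂ} {z : Fin (d + 1) → ℂ}
    (hM : ∀ a b, AnalyticAt ℂ (fun w => M w a b) z) (i : Fin (d + 1)) :
    logPartialDeriv i (fun w => tupleMulVec N (M w)) z
      = tupleMulVec N (Matrix.of fun a b => logPartialDeriv i (fun w => M w a b) z) := by
  have hd : ∀ a b, HasFDerivAt (fun w => M w a b • tupleMulVec N (Matrix.single a b 1))
      ((fderiv ℂ (fun w => M w a b) z).smulRight (tupleMulVec N (Matrix.single a b 1))) z :=
    fun a b => HasFDerivAt.smul_const (hM a b).differentiableAt.hasFDerivAt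
      (tupleMulVec N (Matrix.single a b 1))
  have hs := HasFDerivAt.fun_sum (u := Finset.univ) fun a _ =>
    HasFDerivAt.fun_sum (u := Finset.univ) fun b _ => hd a b
  rw [tupleMulVec_eq_sum]
  simp only [tupleMulVec_eq_sum (M _)]
  rw [logPartialDeriv, partialDeriv, hs.fderiv]
  simp [logPartialDeriv, partialDeriv, Finset.smul_sum, smul_smul, _root_.sum_apply]

/-- The coefficients of the logarithmic system satisfied by the tuple of coefficients of a
logarithmic expansion. -/
noncomputable def tupleSystem {d r : ℕ} (N : ℕ)
    (P : Fin (d + 1) → (Fin (d + 1) → ℂ) → Matrix (Fin r) (Fin r) ℂ) (i : Fin (d + 1))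
    (z : Fin (d + 1) → ℂ) : (Fin (N + 1) → Fin r → ℂ) →L[ℂ] (Fin (N + 1) → Fin r → ℂ) :=
  tupleMulVec N (P i z) - if i = 0 then tupleShift r N else 0

variable {d r N : ℕ} {P : Fin (d + 1) → (Fin (d + 1) → ℂ) → Matrix (Fin r) (Fin r) ℂ}

theorem analyticAt_tupleSystem {z : Fin (d + 1) → ℂ} {i : Fin (d + 1)}
    (hP : ∀ a b, AnalyticAt ℂ (fun z => P i z a b) z) : AnalyticAt ℂ (tupleSystem N P i) z :=
  (analyticAt_tupleMulVec hP).sub analyticAt_const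

theorem tupleSystem_succ (i : Fin d) (z : Fin (d + 1) → ℂ) (v : Fin (N + 1) → Fin r → ℂ)
    (n : Fin (N + 1)) : tupleSystem N P i.succ z v n = (P i.succ z).mulVec (v n) := by
  simp [tupleSystem]

theorem tupleSystem_zero_eq_zero_iff (z : Fin (d + 1) → ℂ) (v : Fin (N + 1) → Fin r → ℂ) :
    tupleSystem N P 0 z v = 0 ↔
      (∀ n : Fin N, (P 0 z).mulVec (v n.castSucc) = (((n : ℕ) : ℂ) + 1) • v n.succ) ∧
      (P 0 z).mulVec (v (Fin.last N)) = 0 := by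
  rw [funext_iff, Fin.forall_fin_succ']
  simp [tupleSystem, sub_eq_zero]

/-- The shift brings in only the component of next higher index. The eigenvector equation is
therefore triangular, and its components vanish from the last one down; finite dimension turns
injectivity into invertibility. -/
theorem natCast_notMem_spectrum_tupleSystem {k : ℂ} {z : Fin (d + 1) → ℂ}
    (hk : k ∉ spectrum ℂ (P 0 z)) : k ∉ spectrum ℂ (tupleSystem N P 0 z) := by
  have hinj : ∀ w : Fin r → ℂ, (P 0 z).mulVec w = k • w → w = 0 := fun w hw => by
    refine Matrix.mulVec_injective_iff_isUnit.2 (spectrum.notMem_iff.1 hk) ?_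
    simp [Matrix.sub_mulVec, Algebra.algebraMap_eq_smul_one, Matrix.smul_mulVec, hw]
  rw [spectrum.notMem_iff, ContinuousLinearMap.isUnit_iff_bijective]
  suffices h : Function.Injective
      (algebraMap ℂ ((Fin (N + 1) → Fin r → ℂ) →L[ℂ] (Fin (N + 1) → Fin r → ℂ)) k
        - tupleSystem N P 0 z).toLinearMap from ⟨h, LinearMap.injective_iff_surjective.1 h⟩
  refine (injective_iff_map_eq_zero _).2 fun v hv => ?_
  have hv' : ∀ n, (P 0 z).mulVec (v n) - tupleShift r N v n = k • v n := fun n => by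
    have := congrFun hv n
    simp only [ContinuousLinearMap.coe_coe, sub_apply, Algebra.algebraMap_eq_smul_one, smul_apply,
      one_apply_eq_self, Pi.sub_apply, Pi.smul_apply, Pi.zero_apply, tupleSystem,
      if_true, tupleMulVec_apply] at this
    exact (sub_eq_zero.1 this).symm
  ext1 n
  refine Fin.reverseInduction (motive := fun n => v n = 0) ?_ (fun n hn => ?_) n
  · exact hinj _ (by simpa using hv' (Fin.last N))
  · exact hinj _ (by simpa [hn] using hv' n.castSucc)

end Operators

/-! ### Flatness across the hyperplane `z₁ = 0`. -/

section Integrability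

variable {d r : ℕ} {P : Fin (d + 1) → (Fin (d + 1) → ℂ) → Matrix (Fin r) (Fin r) ℂ}

theorem logWeight_ne_zero {z : Fin (d + 1) → ℂ} (hz : z 0 ≠ 0) (i : Fin (d + 1)) :
    logWeight i z ≠ 0 := by
  unfold logWeight
  split_ifs
  · exact hz
  · exact one_ne_zero

theorem logPfaffian_eq_inv_logWeight_smul (i : Fin (d + 1)) (z : Fin (d + 1) → ℂ) :
    logPfaffian P i z = (logWeight i z)⁻¹ • P i z := by
  unfold logPfaffian logWeight
  split_ifs with h
  · rw [h]
  · simp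

theorem logWeight_smul_logPfaffian {z : Fin (d + 1) → ℂ} (hz : z 0 ≠ 0) (i : Fin (d + 1)) :
    logWeight i z • logPfaffian P i z = P i z := by
  rw [logPfaffian_eq_inv_logWeight_smul, smul_inv_smul₀ (logWeight_ne_zero hz i)]

/-- The weight of index `j` is constant along the field of index `i ≠ j`, so it factors out.
Multiplying the integrability condition by both weights thus gives its logarithmic form without
extra terms. -/
theorem logPartialDeriv_entry_of_ne {z : Fin (d + 1) → ℂ} (hz : z 0 ≠ 0) {i j : Fin (d + 1)}
    (hij : i ≠ j) {a b : Fin r} (hP : AnalyticAt ℂ (fun w => P j w a b) z) :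
    logPartialDeriv i (fun w => P j w a b) z = logWeight j z *
      (logWeight i z * partialDeriv i (fun w => logPfaffian P j w a b) z) := by
  have hne : ∀ᶠ w in 𝓝 z, w 0 ≠ 0 :=
    (continuous_apply (0 : Fin (d + 1))).continuousAt.eventually_ne hz
  have heq : (fun w => P j w a b) =ᶠ[𝓝 z] fun w => logWeight j w • logPfaffian P j w a b := by
    filter_upwards [hne] with w hw
    rw [← Matrix.smul_apply, logWeight_smul_logPfaffian hw]
  have han : AnalyticAt ℂ (fun w => logPfaffian P j w a b) z := by
    simp only [logPfaffian_eq_inv_logWeight_smul, Matrix.smul_apply]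
    exact ((analyticAt_logWeight j z).inv (logWeight_ne_zero hz j)).smul hP
  rw [heq.logPartialDeriv_eq, logPartialDeriv_smul (analyticAt_logWeight j z).differentiableAt
    han.differentiableAt, logPartialDeriv_logWeight_of_ne hij, zero_smul, zero_add]
  rfl

/-- Integrability of the Pfaffian system in terms of the logarithmic vector fields, which holds
across `z₁ = 0`. -/
theorem integrable_entries (hP : ∀ i a b, AnalyticAt ℂ (fun z => P i z a b) 0)
    (hint : IsIntegrablePfaffian (logPfaffian P)) :
    ∀ᶠ z in 𝓝 (0 : Fin (d + 1) → ℂ), ∀ i j a b,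
      logPartialDeriv i (fun w => P j w a b) z - logPartialDeriv j (fun w => P i w a b) z
        = (P i z * P j z - P j z * P i z) a b := by
  have hPe : ∀ᶠ z in 𝓝 (0 : Fin (d + 1) → ℂ), ∀ i a b, AnalyticAt ℂ (fun z => P i z a b) z :=
    eventually_all.2 fun i => eventually_all.2 fun a => eventually_all.2 fun b =>
      (hP i a b).eventually_analyticAt
  refine eventually_all.2 fun i => eventually_all.2 fun j => eventually_all.2 fun a =>
    eventually_all.2 fun b => ?_
  have hzero : ∀ᶠ z in 𝓝 (0 : Fin (d + 1) → ℂ), logPartialDeriv i (fun w => P j w a b) z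
      - logPartialDeriv j (fun w => P i w a b) z - (P i z * P j z - P j z * P i z) a b = 0 := by
    refine eventually_eq_zero_of_forall_ne (hPe.mono fun z hz => ?_) ?_
    · refine ((((hz j a b).logPartialDeriv i).sub ((hz i a b).logPartialDeriv j)).sub ?_
        ).continuousAt
      simp only [Matrix.sub_apply, Matrix.mul_apply]
      exact (Finset.univ.analyticAt_fun_sum fun c _ => (hz i a c).mul (hz j c b)).sub
        (Finset.univ.analyticAt_fun_sum fun c _ => (hz j a c).mul (hz i c b))
    · filter_upwards [hPe, hint] with z hz hzint hz0
      by_cases hij : i = j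
      · simp [hij]
      · rw [logPartialDeriv_entry_of_ne hz0 hij (hz j a b),
          logPartialDeriv_entry_of_ne hz0 (Ne.symm hij) (hz i a b)]
        have h1 := hzint hz0 i j a b
        rw [← logWeight_smul_logPfaffian (P := P) hz0 i,
          ← logWeight_smul_logPfaffian (P := P) hz0 j]
        simp only [smul_mul_assoc, mul_smul_comm, Matrix.sub_apply, Matrix.smul_apply,
          smul_eq_mul] at h1 ⊢
        linear_combination logWeight i z * logWeight j z * h1
  exact hzero.mono fun z hz => sub_eq_zero.1 hz

/-- Subtracting the shift changes neither side: it is constant, and it commutes with every matrix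
acting componentwise. -/
theorem tupleSystem_flat {N : ℕ} (hP : ∀ i a b, AnalyticAt ℂ (fun z => P i z a b) 0)
    (hint : IsIntegrablePfaffian (logPfaffian P)) :
    ∀ᶠ z in 𝓝 (0 : Fin (d + 1) → ℂ), ∀ i j,
      logPartialDeriv i (tupleSystem N P j) z - logPartialDeriv j (tupleSystem N P i) z
        = tupleSystem N P i z * tupleSystem N P j z
          - tupleSystem N P j z * tupleSystem N P i z := by
  have hPe : ∀ᶠ z in 𝓝 (0 : Fin (d + 1) → ℂ), ∀ i a b, AnalyticAt ℂ (fun z => P i z a b) z :=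
    eventually_all.2 fun i => eventually_all.2 fun a => eventually_all.2 fun b =>
      (hP i a b).eventually_analyticAt
  filter_upwards [hPe, integrable_entries hP hint] with z hz hf i j
  have hd : ∀ i j, logPartialDeriv i (tupleSystem N P j) z
      = tupleMulVec N (Matrix.of fun a b => logPartialDeriv i (fun w => P j w a b) z) := by
    intro i j
    rw [← logPartialDeriv_tupleMulVec (hz j) i]
    simp only [logPartialDeriv, partialDeriv]
    congr 2
    exact fderiv_sub_const _
  have hmat : (Matrix.of fun a b => logPartialDeriv i (fun w => P j w a b) z)
      - (Matrix.of fun a b => logPartialDeriv j (fun w => P i w a b) z)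
      = P i z * P j z - P j z * P i z := by
    ext a b
    exact hf i j a b
  rw [hd, hd, ← map_sub, hmat, map_sub, tupleMulVec_mul, tupleMulVec_mul]
  simp only [tupleSystem]
  have hs : ∀ k : Fin (d + 1), Commute (if k = 0 then tupleShift r N else 0)
      (tupleMulVec N (P i z)) ∧ Commute (if k = 0 then tupleShift r N else 0)
      (tupleMulVec N (P j z)) := fun k => by
    split_ifs
    · exact ⟨tupleShift_mul_tupleMulVec _, tupleShift_mul_tupleMulVec _⟩
    · exact ⟨Commute.zero_left _, Commute.zero_left _⟩
  have hss : Commute (if i = 0 then tupleShift r N else 0)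
      (if j = 0 then tupleShift r N else 0) := by
    split_ifs <;> simp
  simp only [sub_mul, mul_sub]
  rw [(hs i).2.eq, (hs j).1.eq, hss.eq]
  abel

end Integrability

/-! ### Logarithmic expansions as solutions of the tuple system. -/

section Solutions

variable {d r N : ℕ} {P : Fin (d + 1) → (Fin (d + 1) → ℂ) → Matrix (Fin r) (Fin r) ℂ}

theorem logPartialDeriv_log_pow {z : Fin (d + 1) → ℂ} (hz : z 0 ∈ Complex.slitPlane) (n : ℕ)
    (i : Fin (d + 1)) : logPartialDeriv i (fun w => Complex.log (w 0) ^ n) z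
      = if i = 0 then (n : ℂ) * Complex.log (z 0) ^ (n - 1) else 0 := by
  have h1 : HasFDerivAt (fun w : Fin (d + 1) → ℂ => w 0)
      (ContinuousLinearMap.proj (R := ℂ) (φ := fun _ : Fin (d + 1) => ℂ) 0) z :=
    (ContinuousLinearMap.proj (R := ℂ) (φ := fun _ : Fin (d + 1) => ℂ) 0).hasFDerivAt
  have h2 : HasDerivAt (fun t : ℂ => Complex.log t ^ n)
      ((n : ℂ) * Complex.log (z 0) ^ (n - 1) * (z 0)⁻¹) (z 0) := by
    exact (Complex.hasDerivAt_log hz).fun_pow n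
  have h3 := h2.comp_hasFDerivAt z h1
  have hz0 : z 0 ≠ 0 := Complex.slitPlane_ne_zero hz
  rw [logPartialDeriv, partialDeriv, logWeight]
  simp only [Function.comp_def] at h3
  rw [h3.fderiv]
  by_cases hi : i = 0
  · subst hi
    simp
    field_simp
  · simp [hi, Ne.symm hi]

theorem logPartialDeriv_pi_apply {ι : Type*} [Fintype ι] {F : Type*} [NormedAddCommGroup F]
    [NormedSpace ℂ F] {f : ι → (Fin (d + 1) → ℂ) → F} {z : Fin (d + 1) → ℂ}
    (hf : ∀ n, DifferentiableAt ℂ (f n) z) (i : Fin (d + 1)) (n : ι) :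
    logPartialDeriv i (fun w n => f n w) z n = logPartialDeriv i (f n) z := by
  rw [logPartialDeriv, partialDeriv, fderiv_pi hf]
  rfl

/-- The defect of a logarithmic expansion in the Pfaffian system, expressed through the defect
of the tuple of its coefficients in the associated system. -/
theorem logExpansion_defect {I : Fin (N + 1) → (Fin (d + 1) → ℂ) → (Fin r → ℂ)}
    {z : Fin (d + 1) → ℂ} (hz : z 0 ∈ Complex.slitPlane) (hI : ∀ n, AnalyticAt ℂ (I n) z)
    (i : Fin (d + 1)) :
    logWeight i z • (partialDeriv i (logExpansion I) z
        - (logPfaffian P i z).mulVec (logExpansion I z))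
      = logExpansion (fun n w => (logPartialDeriv i (fun w n => I n w) w
        - tupleSystem N P i w (fun n => I n w)) n) z := by
  have hz0 : z 0 ≠ 0 := Complex.slitPlane_ne_zero hz
  have hlog : ∀ n : ℕ, DifferentiableAt ℂ
      (fun w : Fin (d + 1) → ℂ => Complex.log (w 0) ^ n) z := fun n =>
    (DifferentiableAt.clog (differentiableAt_apply 0 z) hz).pow n
  have h1 : logPartialDeriv i (logExpansion I) z = ∑ n : Fin (N + 1),
      ((if i = 0 then ((n : ℕ) : ℂ) * Complex.log (z 0) ^ ((n : ℕ) - 1) else 0) • I n z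
        + Complex.log (z 0) ^ (n : ℕ) • logPartialDeriv i (I n) z) := by
    have h2 : logPartialDeriv i (logExpansion I) z = ∑ n : Fin (N + 1),
        logPartialDeriv i (fun w => Complex.log (w 0) ^ (n : ℕ) • I n w) z := by
      have h3 : logExpansion I = fun w => ∑ n : Fin (N + 1), Complex.log (w 0) ^ (n : ℕ) • I n w :=
        rfl
      simp only [logPartialDeriv, partialDeriv]
      rw [h3, fderiv_fun_sum (A := fun (n : Fin (N + 1)) w => Complex.log (w 0) ^ (n : ℕ) • I n w)
        fun n _ => (hlog n).smul (hI n).differentiableAt]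
      simp [Finset.smul_sum]
    rw [h2]
    refine Finset.sum_congr rfl fun n _ => ?_
    rw [logPartialDeriv_smul (hlog n) (hI n).differentiableAt, logPartialDeriv_log_pow hz]
  rw [smul_sub, ← Matrix.smul_mulVec, logWeight_smul_logPfaffian hz0]
  change logPartialDeriv i (logExpansion I) z - _ = _
  rw [h1]
  simp only [logExpansion, Pi.sub_apply, tupleSystem, sub_apply, tupleMulVec_apply,
    logPartialDeriv_pi_apply fun n => (hI n).differentiableAt, Matrix.mulVec_sum,
    Matrix.mulVec_smul, smul_sub, Finset.sum_sub_distrib, Finset.sum_add_distrib]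
  by_cases hi : i = 0
  · simp only [hi, if_true, sum_pow_smul_tupleShift]
    abel
  · simp [hi]

/-- A logarithmic expansion solves the Pfaffian system if and only if its coefficients solve the
associated system. -/
theorem logExpansion_solution_iff (hP : ∀ i a b, AnalyticAt ℂ (fun z => P i z a b) 0)
    {I : Fin (N + 1) → (Fin (d + 1) → ℂ) → (Fin r → ℂ)} (hI : ∀ n, AnalyticAt ℂ (I n) 0) :
    (∀ᶠ z in slitNhds d, ∀ i : Fin (d + 1),
      partialDeriv i (logExpansion I) z = (logPfaffian P i z).mulVec (logExpansion I z)) ↔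
    ∀ᶠ z in 𝓝 0, ∀ i, logPartialDeriv i (fun w n => I n w) z
      = tupleSystem N P i z (fun n => I n z) := by
  have hIe : ∀ᶠ z in slitNhds d, ∀ n, AnalyticAt ℂ (I n) z :=
    (eventually_all.2 fun n => (hI n).eventually_analyticAt).filter_mono nhdsWithin_le_nhds
  have hslit : ∀ᶠ z in slitNhds d, z 0 ∈ Complex.slitPlane := self_mem_nhdsWithin
  constructor
  · intro h
    refine eventually_all.2 fun i => ?_
    have hY : AnalyticAt ℂ (fun w n => I n w) 0 := analyticAt_pi_iff.2 hI
    have han : AnalyticAt ℂ (fun w => logPartialDeriv i (fun w n => I n w) w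
        - tupleSystem N P i w (fun n => I n w)) 0 :=
      (hY.logPartialDeriv i).sub ((analyticAt_tupleSystem (hP i)).clm_apply hY)
    -- The defect tuple is holomorphic across `z₁ = 0`, so uniqueness of coefficients upgrades
    -- vanishing of its expansion on a slit neighbourhood to vanishing of each entry on a full one.
    have := logExpansion_coeff_eq_zero (I := fun n w => (logPartialDeriv i (fun w n => I n w) w
        - tupleSystem N P i w (fun n => I n w)) n)
      (fun n => analyticAt_pi_iff.1 han n) (by
        filter_upwards [h, hIe, hslit] with z hz hIz hzs
        rw [← logExpansion_defect hzs hIz i, hz i, sub_self, smul_zero])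
    exact this.mono fun z hz => sub_eq_zero.1 (funext hz)
  · intro h
    filter_upwards [h.filter_mono nhdsWithin_le_nhds, hIe, hslit] with z hz hIz hzs i
    have h1 := logExpansion_defect (P := P) hzs hIz i
    have h2 : logExpansion (fun n w => (logPartialDeriv i (fun w n => I n w) w
        - tupleSystem N P i w (fun n => I n w)) n) z = 0 := by
      simp [logExpansion, hz i]
    rw [h2, smul_eq_zero] at h1
    exact sub_eq_zero.1
      (h1.resolve_left (logWeight_ne_zero (Complex.slitPlane_ne_zero hzs) i))

end Solutions

/-! ### Restriction to the hyperplane `z₁ = 0`. -/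

section Boundary

variable {d : ℕ} {F : Type*} [NormedAddCommGroup F] [NormedSpace ℂ F]

/-- The inclusion `z' ↦ (0, z')` of the hyperplane `z₁ = 0`. -/
noncomputable def boundaryInclusion (d : ℕ) : (Fin d → ℂ) →L[ℂ] (Fin (d + 1) → ℂ) :=
  ContinuousLinearMap.pi (Fin.cons 0 fun i => ContinuousLinearMap.proj i)

theorem boundaryInclusion_apply (z' : Fin d → ℂ) : boundaryInclusion d z' = Fin.cons 0 z' := by
  ext i
  refine Fin.cases ?_ (fun i => ?_) i <;> simp [boundaryInclusion]

theorem tendsto_cons_zero :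
    Tendsto (fun z' : Fin d → ℂ => (Fin.cons 0 z' : Fin (d + 1) → ℂ)) (𝓝 0) (𝓝 0) := by
  have h := (boundaryInclusion d).continuous.tendsto 0
  rw [map_zero] at h
  exact h.congr boundaryInclusion_apply

theorem cons_zero_zero : (Fin.cons 0 (0 : Fin d → ℂ) : Fin (d + 1) → ℂ) = 0 := by
  rw [← boundaryInclusion_apply, map_zero]

theorem AnalyticAt.comp_cons_zero {f : (Fin (d + 1) → ℂ) → F}
    {z' : Fin d → ℂ} (hf : AnalyticAt ℂ f (Fin.cons 0 z')) :
    AnalyticAt ℂ (fun w' : Fin d → ℂ => f (Fin.cons 0 w')) z' := by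
  rw [← boundaryInclusion_apply] at hf
  simpa only [Function.comp_def, boundaryInclusion_apply] using
    hf.comp ((boundaryInclusion d).analyticAt z')

theorem partialDeriv_comp_cons_zero {f : (Fin (d + 1) → ℂ) → F} {z' : Fin d → ℂ}
    (hf : AnalyticAt ℂ f (Fin.cons 0 z')) (i : Fin d) :
    partialDeriv i (fun w' : Fin d → ℂ => f (Fin.cons 0 w')) z'
      = logPartialDeriv i.succ f (Fin.cons 0 z') := by
  rw [← boundaryInclusion_apply] at hf ⊢
  have h := hf.differentiableAt.hasFDerivAt.comp z' (boundaryInclusion d).hasFDerivAt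
  simp only [Function.comp_def, boundaryInclusion_apply] at h
  rw [partialDeriv, h.fderiv, logPartialDeriv, logWeight, if_neg (Fin.succ_ne_zero i), one_smul,
    partialDeriv, boundaryInclusion_apply]
  simp only [ContinuousLinearMap.comp_apply, boundaryInclusion_apply]
  congr 1
  ext j
  refine Fin.cases ?_ (fun j => ?_) j
  · simp [(Fin.succ_ne_zero i).symm]
  · simp [Pi.single_apply]

theorem logPartialDeriv_zero_cons_zero (f : (Fin (d + 1) → ℂ) → F) (z' : Fin d → ℂ) :
    logPartialDeriv 0 f (Fin.cons 0 z') = 0 := by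
  simp [logPartialDeriv, logWeight]

/-- Uniqueness of holomorphic solutions of a regular Pfaffian system. -/
theorem pfaffian_unique {n : ℕ} [CompleteSpace F] {B : Fin n → (Fin n → ℂ) → F →L[ℂ] F}
    (hB : ∀ i, AnalyticAt ℂ (B i) 0) {Z : (Fin n → ℂ) → F} (hZ : AnalyticAt ℂ Z 0)
    (h : ∀ᶠ z in 𝓝 0, ∀ i, partialDeriv i Z z = B i z (Z z)) (h0 : Z 0 = 0) :
    ∀ᶠ z in 𝓝 0, Z z = 0 := by
  refine eventually_eq_zero_of_euler (A := fun z => ∑ i, z i • B i z) hZ ?_ ?_ h0 ?_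
  · exact (Finset.univ.analyticAt_fun_sum fun i _ => ((ContinuousLinearMap.proj (R := ℂ)
      (φ := fun _ : Fin n => ℂ) i).analyticAt 0).smul (hB i)).continuousAt
  · filter_upwards [h] with z hz
    rw [fderiv_apply_eq_sum_partialDeriv]
    simp [hz]
  -- The contracted operator `∑ zᵢ Bᵢ` vanishes at the origin, so its only possible eigenvalue there
  -- is `0`.
  · intro k hk v hv
    simp only [Pi.zero_apply, zero_smul, Finset.sum_const_zero, zero_apply] at hv
    exact (smul_eq_zero.1 hv.symm).resolve_left (by exact_mod_cast (by omega : k ≠ 0))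

end Boundary

/-! ### The boundary value map. -/

section BoundaryValueMap

variable {d r N : ℕ} {P : Fin (d + 1) → (Fin (d + 1) → ℂ) → Matrix (Fin r) (Fin r) ℂ}

/-- The boundary values of a solution of the system for the coefficients solve the logarithmic
restriction. -/
theorem boundaryValue_mem_restrictedSolutions
    {I : Fin (N + 1) → (Fin (d + 1) → ℂ) → (Fin r → ℂ)} (hI : ∀ n, AnalyticAt ℂ (I n) 0)
    (hsol : ∀ᶠ z in 𝓝 0, ∀ i, logPartialDeriv i (fun w n => I n w) z
      = tupleSystem N P i z (fun n => I n z)) :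
    (fun n => (boundaryValue (I n) : Germ (𝓝 (0 : Fin d → ℂ)) (Fin r → ℂ)))
      ∈ restrictedSolutions P N := by
  refine ⟨fun n => boundaryValue (I n), fun n => ?_, fun n => rfl, ?_⟩
  · exact AnalyticAt.comp_cons_zero (by rw [cons_zero_zero]; exact hI n)
  have hIe : ∀ᶠ z in 𝓝 0, ∀ n, AnalyticAt ℂ (I n) z :=
    eventually_all.2 fun n => (hI n).eventually_analyticAt
  filter_upwards [tendsto_cons_zero.eventually hsol, tendsto_cons_zero.eventually hIe]
    with z' hz' hIz
  refine ⟨fun i n => ?_, ?_⟩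
  · have h1 := congrFun (hz' i.succ) n
    rw [logPartialDeriv_pi_apply (fun n => (hIz n).differentiableAt), tupleSystem_succ] at h1
    exact (partialDeriv_comp_cons_zero (hIz n) i).trans h1
  · refine (tupleSystem_zero_eq_zero_iff _ fun n => I n (Fin.cons 0 z')).1 ?_
    rw [← hz' 0, logPartialDeriv_zero_cons_zero]

/-- The residue relation gives `(n + 1) J⁽ⁿ⁺¹⁾` from `J⁽ⁿ⁾`, and `n + 1` is invertible. -/
theorem restrictedSolutions_eq_of_zero_eq
    {G G' : Fin (N + 1) → Germ (𝓝 (0 : Fin d → ℂ)) (Fin r → ℂ)}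
    (hG : G ∈ restrictedSolutions P N) (hG' : G' ∈ restrictedSolutions P N) (h : G 0 = G' 0) :
    G = G' := by
  obtain ⟨J, -, hGJ, hJ⟩ := hG
  obtain ⟨J', -, hGJ', hJ'⟩ := hG'
  ext1 n
  rw [hGJ, hGJ']
  refine Fin.induction (motive := fun n => (J n : Germ (𝓝 (0 : Fin d → ℂ)) (Fin r → ℂ)) = J' n)
    ?_ (fun n hn => ?_) n
  · rw [← hGJ, ← hGJ', h]
  · refine Germ.coe_eq.2 ?_
    filter_upwards [hJ, hJ', Germ.coe_eq.1 hn] with z' h1 h2 h3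
    have h4 : (((n : ℕ) : ℂ) + 1) ≠ 0 := Nat.cast_add_one_ne_zero _
    refine smul_right_injective _ h4 ?_
    change (((n : ℕ) : ℂ) + 1) • J n.succ z' = (((n : ℕ) : ℂ) + 1) • J' n.succ z'
    rw [← h1.2.1 n, ← h2.2.1 n, h3]

/-- Each solution of the logarithmic restriction is the boundary value of a logarithmic
solution. -/
theorem exists_logSolution_of_restricted (hP : ∀ i a b, AnalyticAt ℂ (fun z => P i z a b) 0)
    (hint : IsIntegrablePfaffian (logPfaffian P))
    (hpos : ∀ k : ℕ, 1 ≤ k → (k : ℂ) ∉ spectrum ℂ (P 0 0))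
    {G : Fin (N + 1) → Germ (𝓝 (0 : Fin d → ℂ)) (Fin r → ℂ)}
    (hG : G ∈ restrictedSolutions P N) :
    ∃ I : Fin (N + 1) → (Fin (d + 1) → ℂ) → (Fin r → ℂ), (∀ n, AnalyticAt ℂ (I n) 0) ∧
      (∀ᶠ z in 𝓝 0, ∀ i, logPartialDeriv i (fun w n => I n w) z
        = tupleSystem N P i z (fun n => I n z)) ∧
      ∀ n, (boundaryValue (I n) : Germ (𝓝 (0 : Fin d → ℂ)) (Fin r → ℂ)) = G n := by
  obtain ⟨J, hJa, hGJ, hJ⟩ := hG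
  have hker : tupleSystem N P 0 0 (fun n => J n 0) = 0 := by
    have := hJ.self_of_nhds.2
    rw [cons_zero_zero] at this
    exact (tupleSystem_zero_eq_zero_iff _ _).2 this
  obtain ⟨Y, hY, hY0, hsol⟩ := exists_logSystem_solution
    (fun i => analyticAt_tupleSystem (N := N) (hP i))
    (fun k hk => natCast_notMem_spectrum_tupleSystem (hpos k hk)) (tupleSystem_flat hP hint) hker
  have hYn : ∀ n, AnalyticAt ℂ (fun z => Y z n) 0 := analyticAt_pi_iff.1 hY
  refine ⟨fun n z => Y z n, hYn, hsol, fun n => ?_⟩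
  rw [hGJ n]
  refine Germ.coe_eq.2 ?_
  have hYb : AnalyticAt ℂ (fun w' : Fin d → ℂ => Y (Fin.cons 0 w')) 0 :=
    AnalyticAt.comp_cons_zero (by rw [cons_zero_zero]; exact hY)
  have hJt : AnalyticAt ℂ (fun w' n => J n w') 0 := analyticAt_pi_iff.2 hJa
  -- `Y` was built from the single vector `J 0`. Its restriction and `J` solve the same regular
  -- system in `z'` with the same initial value, so they agree near the origin.
  have hdiff : ∀ᶠ z' in 𝓝 (0 : Fin d → ℂ), Y (Fin.cons 0 z') - (fun n => J n z') = 0 := by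
    refine pfaffian_unique (B := fun i z' => tupleSystem N P i.succ (Fin.cons 0 z'))
      (fun i => ?_) (hYb.sub hJt) ?_ ?_
    · refine AnalyticAt.comp_cons_zero (f := tupleSystem N P i.succ) ?_
      rw [cons_zero_zero]
      exact analyticAt_tupleSystem (hP i.succ)
    · filter_upwards [tendsto_cons_zero.eventually hsol, hJ, hYb.eventually_analyticAt,
        hJt.eventually_analyticAt, tendsto_cons_zero.eventually hY.eventually_analyticAt]
        with z' h1 h2 h3 h4 h5 i
      have h6 : partialDeriv i (fun w' n => J n w') z'
          = tupleSystem N P i.succ (Fin.cons 0 z') (fun n => J n z') := by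
        ext1 n
        rw [tupleSystem_succ, ← h2.1 i n, partialDeriv,
          fderiv_pi fun n => (analyticAt_pi_iff.1 h4 n).differentiableAt]
        rfl
      have h7 := (partialDeriv_comp_cons_zero h5 i).trans (h1 i.succ)
      rw [map_sub, ← h6, ← h7]
      simp only [partialDeriv]
      exact congrArg (fun T : (Fin d → ℂ) →L[ℂ] (Fin (N + 1) → Fin r → ℂ) => T (Pi.single i 1))
        (fderiv_sub h3.differentiableAt h4.differentiableAt)
    · change Y (Fin.cons 0 0) - (fun n => J n 0) = 0
      rw [cons_zero_zero, hY0, sub_self]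
  filter_upwards [hdiff] with z' hz'
  exact congrFun (sub_eq_zero.1 hz') n

/-- A logarithmic solution is determined by its boundary values. -/
theorem logExpansion_eq_of_boundaryValue_eq
    (hP : ∀ i a b, AnalyticAt ℂ (fun z => P i z a b) 0)
    (hpos : ∀ k : ℕ, 1 ≤ k → (k : ℂ) ∉ spectrum ℂ (P 0 0))
    {I I' : Fin (N + 1) → (Fin (d + 1) → ℂ) → (Fin r → ℂ)} (hI : ∀ n, AnalyticAt ℂ (I n) 0)
    (hI' : ∀ n, AnalyticAt ℂ (I' n) 0)
    (hsol : ∀ᶠ z in 𝓝 0, ∀ i, logPartialDeriv i (fun w n => I n w) z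
      = tupleSystem N P i z (fun n => I n z))
    (hsol' : ∀ᶠ z in 𝓝 0, ∀ i, logPartialDeriv i (fun w n => I' n w) z
      = tupleSystem N P i z (fun n => I' n z))
    (h : ∀ n, boundaryValue (I n) =ᶠ[𝓝 0] boundaryValue (I' n)) :
    logExpansion I =ᶠ[slitNhds d] logExpansion I' := by
  have hY : AnalyticAt ℂ (fun w n => I n w) 0 := analyticAt_pi_iff.2 hI
  have hY' : AnalyticAt ℂ (fun w n => I' n w) 0 := analyticAt_pi_iff.2 hI'
  have hdiff := logSystem_unique (fun i => analyticAt_tupleSystem (N := N) (hP i))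
    (fun k hk => natCast_notMem_spectrum_tupleSystem (hpos k hk))
    (Y := fun w => (fun n => I n w) - fun n => I' n w) (hY.sub hY') (by
      filter_upwards [hsol, hsol', hY.eventually_analyticAt, hY'.eventually_analyticAt]
        with z h1 h2 h3 h4 i
      rw [logPartialDeriv_sub h3.differentiableAt h4.differentiableAt, h1, h2, map_sub]) (by
      ext1 n
      have := (h n).self_of_nhds
      simp only [boundaryValue, cons_zero_zero] at this
      exact sub_eq_zero.2 this)
  filter_upwards [hdiff.filter_mono nhdsWithin_le_nhds] with z hz
  have hz' : ∀ n, I n z = I' n z := congrFun (sub_eq_zero.1 hz)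
  simp only [logExpansion, hz']

end BoundaryValueMap

/-! ### The correspondence. -/

theorem mainTheorem2 (d r N : ℕ)
    (P : Fin (d + 1) → (Fin (d + 1) → ℂ) → Matrix (Fin r) (Fin r) ℂ)
    (hP : ∀ (i : Fin (d + 1)) (a b : Fin r), AnalyticAt ℂ (fun z => P i z a b) 0)
    (hint : IsIntegrablePfaffian (logPfaffian P))
    (hres : NonResonant (P 0 0))
    (hpos : ∀ k : ℕ, 1 ≤ k → (k : ℂ) ∉ spectrum ℂ (P 0 0)) :
    -- the coefficients of a logarithmic expansion are determined by the function it represents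
    (∀ I I' : Fin (N + 1) → (Fin (d + 1) → ℂ) → (Fin r → ℂ),
      (∀ n, AnalyticAt ℂ (I n) 0) → (∀ n, AnalyticAt ℂ (I' n) 0) →
      logExpansion I =ᶠ[slitNhds d] logExpansion I' → ∀ n, I n =ᶠ[𝓝 0] I' n) ∧
    -- the boundary value map is a one-to-one correspondence, and `I⁽⁰⁾(0, z')` determines it
    ∃ B : logSolutions P N ≃ restrictedSolutions P N,
      (∀ (F : logSolutions P N) (I : Fin (N + 1) → (Fin (d + 1) → ℂ) → (Fin r → ℂ)),
        (∀ n, AnalyticAt ℂ (I n) 0) →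
        F.1 = (logExpansion I : Germ (slitNhds d) (Fin r → ℂ)) →
        ∀ n, (B F).1 n = (boundaryValue (I n) : Germ (𝓝 (0 : Fin d → ℂ)) (Fin r → ℂ))) ∧
      Function.Injective (fun F : logSolutions P N => (B F).1 0) := by

  refine ⟨fun I I' hI hI' h n => logExpansion_coeff_unique hI hI' h n, ?_⟩
  choose I hI hFI hsol using fun F : logSolutions P N => F.2
  have hsys := fun F => (logExpansion_solution_iff hP (hI F)).1 (hsol F)
  let b : logSolutions P N → restrictedSolutions P N := fun F =>
    ⟨_, boundaryValue_mem_restrictedSolutions (hI F) (hsys F)⟩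
  -- The map is defined through chosen coefficients; uniqueness of coefficients makes it independent
  -- of the choice.
  have hb : ∀ (F : logSolutions P N) (I' : Fin (N + 1) → (Fin (d + 1) → ℂ) → (Fin r → ℂ)),
      (∀ n, AnalyticAt ℂ (I' n) 0) →
      F.1 = (logExpansion I' : Germ (slitNhds d) (Fin r → ℂ)) →
      ∀ n, (b F).1 n = (boundaryValue (I' n) : Germ (𝓝 (0 : Fin d → ℂ)) (Fin r → ℂ)) := by
    intro F I' hI' hF n
    refine Germ.coe_eq.2 (tendsto_cons_zero.eventually (logExpansion_coeff_unique (hI F) hI' ?_ n))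
    exact Germ.coe_eq.1 ((hFI F).symm.trans hF)
  have hinj : Function.Injective b := fun F F' h => by
    apply Subtype.ext
    rw [hFI F, hFI F']
    refine Germ.coe_eq.2 (logExpansion_eq_of_boundaryValue_eq hP hpos (hI F) (hI F') (hsys F)
      (hsys F') fun n => Germ.coe_eq.1 ?_)
    exact congrFun (congrArg Subtype.val h) n
  have hsurj : Function.Surjective b := fun G => by
    obtain ⟨I', hI', hsol', hG⟩ := exists_logSolution_of_restricted hP hint hpos G.2
    let F : logSolutions P N :=
      ⟨_, I', hI', rfl, (logExpansion_solution_iff hP hI').2 hsol'⟩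
    refine ⟨F, Subtype.ext (funext fun n => ?_)⟩
    rw [hb F I' hI' rfl n, hG n]
  refine ⟨Equiv.ofBijective b ⟨hinj, hsurj⟩, hb, fun F F' h => hinj (Subtype.ext ?_)⟩
  exact restrictedSolutions_eq_of_zero_eq (b F).2 (b F').2 h
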